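/- \textbf{Setting.} Let $d\ge 1$ be the dimension and let $a>0$ be fixed. Let $L>1$ be an odd integer, let $1\le k\le m$ be integers and let $\bar\mu_0\ge 0$. Put $\xi=L^{-k}$, $\bar\mu_k=L^{2k}\bar\mu_0$ and $a_k=a\,\frac{1-L^{-2}}{1-L^{-2k}}$. Consider the fine lattice $\Omega=\xi\{0,1,\dots,L^m\}^{d}$ and the coarse unit lattice $\Omega_k=\{0,1,\dots,L^{m-k}\}^{d}=L^k\xi\{0,1,\dots,L^{m-k}\}^d$, with the complex Hilbert spaces $\mathcal L^2(\Omega)$, $\langle f,g\rangle=\xi^d\sum_{x\in\Omega}\overline{f(x)}g(x)$, and $\mathcal L^2(\Omega_k)$, $\langle f,g\rangle=\sum_{y\in\Omega_k}\overline{f(y)}g(y)$. Let $\Delta^\xi_\Omega=\sum_{\mu}1\otimes\cdots\otimes\Delta^\xi_I\otimes\cdots\otimes1$ be the Laplacian on $\Omega$ with Neumann boundary conditions, where on $I=\xi\{0,\dots,L^m\}$ one has $(\Delta_I^\xi f)_\kappa=\xi^{-2}(f_{\kappa+1}-2f_\kappa+f_{\kappa-1})$ with $f_{-1}:=f_0$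 and $f_{L^m+1}:=f_{L^m}$. Let $Q_{\Omega,k}:\mathcal L^2(\Omega)\to\mathcal L^2(\Omega_k)$ be the averaging operator $$(Q_{\Omega,k}f)(z)=\frac1{L^{kd}}\sum_{x\in\Omega,\ z_\mu\le x_\mu<z_\mu+1\ \forall\mu} f(x),$$ with adjoint $(Q_{\Omega,k}^*h)(x)=h(([x_\mu])_\mu)$, where $[\cdot]$ is the integer part. Put $$G_k(\Omega)=\big(-\Delta^\xi_\Omega+\bar\mu_k+a_kQ_{\Omega,k}^*Q_{\Omega,k}\big)^{-1},\qquad \mathcal H_k(\Omega)=a_kG_k(\Omega)Q_{\Omega,k}^*.$$ For a linear map $A:\mathcal L^2(\Omega_k)\to\mathcal L^2(\Omega)$ the kernel is $A(x,y)=\langle\delta^\xi_x,A\delta^1_y\rangle$, where $\delta^\xi_x=\xi^{-d}\mathbf 1_{\{x\}}$ and $\delta^1_y=\mathbf 1_{\{y\}}$. \textbf{Theorem.} There are constants $c,c_1>0$, depending only on $d$ (and on the fixed number $a$), such that for all $L,k,m,\bar\mu_0$ as above the operator $-\Delta^\xi_\Omega+\bar\mu_k+a_kQ_{\Omega,k}^*Q_{\Omega,k}$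 is invertible and, for all $x\in\Omega$ and $y\in\Omega_k$, $$|(G_k(\Omega)Q_{\Omega,k}^*)(x,y)|\le c\,e^{-c_1|x-y|}\qquad\text{and}\qquad|\mathcal H_k(\Omega)(x,y)|\le c\,e^{-c_1|x-y|},$$ where $|x-y|$ is the Euclidean distance. In particular the constants do not depend on the lattice spacing, on the size of $\Omega$, on $L$ or on the mass. -/

import Mathlib

open scoped ComplexConjugate

noncomputable section

namespace LatticeGreen

/-- The scalar product `⟨f, g⟩ = h ^ d * ∑ x, conj (f x) * g x` of `ℒ²(X)`, where `X` indexes the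
points of a `d`-dimensional lattice region with lattice spacing `h`. -/
def latticeInner {X : Type*} [Fintype X] (d : ℕ) (h : ℝ) (f g : X → ℂ) : ℂ :=
  (h : ℂ) ^ d * ∑ x, conj (f x) * g x

/-- The lattice Dirac delta `h ^ (-d) * 1_{x}` at `x`. -/
def latticeDelta {X : Type*} [DecidableEq X] (d : ℕ) (h : ℝ) (x : X) : X → ℂ :=
  Pi.single x (((h : ℂ) ^ d)⁻¹)

/-- The kernel `A(x, y) = ⟨δ_x, A δ_y⟩` of a linear map `A : ℒ²(Y) → ℒ²(X)`, where `Y` has lattice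
spacing `hY` and `X` has lattice spacing `hX`. -/
def latticeKernel {X Y : Type*} [Fintype X] [DecidableEq X] [DecidableEq Y] (d : ℕ) (hX hY : ℝ)
    (A : (Y → ℂ) →ₗ[ℂ] (X → ℂ)) (x : X) (y : Y) : ℂ :=
  latticeInner d hX (latticeDelta d hX x) (A (latticeDelta d hY y))

theorem latticeInner_latticeDelta {X : Type*} [Fintype X] [DecidableEq X] (d : ℕ) {h : ℝ}
    (hh : h ≠ 0) (x : X) (f : X → ℂ) : latticeInner d h (latticeDelta d h x) f = f x := by
  have h0 : (h : ℂ) ^ d ≠ 0 := pow_ne_zero _ (by exact_mod_cast hh)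
  unfold latticeInner latticeDelta
  rw [Finset.sum_eq_single x]
  · simp only [Pi.single_eq_same, map_inv₀, map_pow, Complex.conj_ofReal]
    field_simp
  · intro b _ hb
    simp [hb]
  · simp

/-- The lattice spacing `ξ = L ^ (-k)`. -/
def spacing (L k : ℕ) : ℝ := ((L : ℝ) ^ k)⁻¹

/-- The fine lattice `Ω = ξ [0, 1, …, L ^ m] ^ d`; the point `x = ξ κ` is represented by its integer
coordinates `κ`. -/
abbrev Fine (d L m : ℕ) : Type := Fin d → Fin (L ^ m + 1)

/-- The coarse lattice `Ω_k = (L ^ k ξ) [0, 1, …, L ^ (m - k)] ^ d`, which has spacing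
`L ^ k ξ = 1`; again a point is represented by its integer coordinates. -/
abbrev Coarse (d L k m : ℕ) : Type := Fin d → Fin (L ^ (m - k) + 1)

/-- The position in `ℝ ^ d` of the point with integer coordinates `x` in a lattice region of
spacing `h`. -/
def position {d N : ℕ} (h : ℝ) (x : Fin d → Fin N) : EuclideanSpace ℝ (Fin d) :=
  WithLp.toLp 2 fun i => h * ((x i : ℕ) : ℝ)

/-- The right neighbour in `{0, …, N}`, with `N` sent to itself: this encodes the boundary condition
`f (N + 1) := f N`. -/
def nextSite {N : ℕ} (i : Fin (N + 1)) : Fin (N + 1) :=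
  ⟨min ((i : ℕ) + 1) N, Nat.lt_succ_of_le (min_le_right _ _)⟩

/-- The left neighbour in `{0, …, N}`, with `0` sent to itself: this encodes the boundary condition
`f (-1) := f 0`. -/
def prevSite {N : ℕ} (i : Fin (N + 1)) : Fin (N + 1) :=
  ⟨(i : ℕ) - 1, lt_of_le_of_lt (Nat.sub_le _ _) i.isLt⟩

/-- The Laplacian on the interval `ξ [0, 1, …, N]` with Neumann boundary conditions. -/
def intervalLaplacian (ξ : ℝ) (N : ℕ) : (Fin (N + 1) → ℂ) →ₗ[ℂ] (Fin (N + 1) → ℂ) where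
  toFun f i := (f (nextSite i) - 2 * f i + f (prevSite i)) / (ξ : ℂ) ^ 2
  map_add' f g := by
    funext i
    simp only [Pi.add_apply]
    ring
  map_smul' c f := by
    funext i
    simp only [Pi.smul_apply, smul_eq_mul, RingHom.id_apply]
    ring

/-- The Laplacian `∑ μ, 1 ⊗ ⋯ ⊗ Δ_I ⊗ ⋯ ⊗ 1` (with `Δ_I` at position `μ`) on the cube
`ξ [0, 1, …, N] ^ d` with Neumann boundary conditions. -/
def neumannLaplacian (d : ℕ) (ξ : ℝ) (N : ℕ) :
    (((Fin d → Fin (N + 1)) → ℂ)) →ₗ[ℂ] ((Fin d → Fin (N + 1)) → ℂ) where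
  toFun f x := ∑ μ : Fin d, intervalLaplacian ξ N (fun t => f (Function.update x μ t)) (x μ)
  map_add' f g := by
    funext x
    simp only [Pi.add_apply, ← Finset.sum_add_distrib]
    refine Finset.sum_congr rfl fun μ _ => ?_
    exact congrFun ((intervalLaplacian ξ N).map_add (fun t => f (Function.update x μ t))
      (fun t => g (Function.update x μ t))) (x μ)
  map_smul' c f := by
    funext x
    simp only [Pi.smul_apply, smul_eq_mul, RingHom.id_apply, Finset.mul_sum]
    refine Finset.sum_congr rfl fun μ _ => ?_
    exact congrFun ((intervalLaplacian ξ N).map_smul c (fun t => f (Function.update x μ t))) (x μ)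

/-- The part in `Ω` of the box `B_k(z) = {x | z_μ ≤ x_μ < z_μ + L ^ k ξ for all μ}`, in integer
coordinates (the label `z` has position `L ^ k ξ z`). -/
def block {d L k m : ℕ} (z : Coarse d L k m) : Finset (Fine d L m) :=
  Finset.univ.filter fun x =>
    ∀ i, L ^ k * (z i : ℕ) ≤ (x i : ℕ) ∧ (x i : ℕ) < L ^ k * (z i : ℕ) + L ^ k

/-- The averaging operator `Q_{Ω,k} : ℒ²(Ω) → ℒ²(Ω_k)`,
`(Q_{Ω,k} f)(z) = L ^ (-kd) ∑_{x ∈ B_k(z)} f(x)`. -/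
def averaging (d L k m : ℕ) : (Fine d L m → ℂ) →ₗ[ℂ] (Coarse d L k m → ℂ) where
  toFun f z := ((L : ℂ) ^ (k * d))⁻¹ * ∑ x ∈ block z, f x
  map_add' f g := by
    funext z
    simp only [Pi.add_apply, Finset.sum_add_distrib, mul_add]
  map_smul' c f := by
    funext z
    simp only [Pi.smul_apply, smul_eq_mul, RingHom.id_apply, ← Finset.mul_sum]
    ring

theorem div_pow_lt {L k m a : ℕ} (ha : a < L ^ m + 1) : a / L ^ k < L ^ (m - k) + 1 := by
  have ha' : a ≤ L ^ m := Nat.lt_succ_iff.mp ha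
  refine Nat.lt_succ_of_le ?_
  rcases Nat.eq_zero_or_pos (L ^ k) with h0 | hpos
  · simp [h0]
  · refine Nat.div_le_of_le_mul (ha'.trans ?_)
    rw [← pow_add]
    rcases Nat.eq_zero_or_pos L with rfl | hL
    · have hk : k = 0 := by
        by_contra hk
        simp [hk] at hpos
      simp [hk]
    · exact Nat.pow_le_pow_right hL (by omega)

/-- The label `y_x` of the box to which `x` belongs: `(y_x)_μ = [x_μ / (L ^ k ξ)] (L ^ k ξ)`. -/
def blockLabel {d L k m : ℕ} (x : Fine d L m) : Coarse d L k m :=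
  fun i => ⟨(x i : ℕ) / L ^ k, div_pow_lt (x i).isLt⟩

/-- The adjoint `Q_{Ω,k}^* : ℒ²(Ω_k) → ℒ²(Ω)`, `(Q_{Ω,k}^* h)(x) = h(y_x)`; see
`latticeInner_averaging`. -/
def averagingAdjoint (d L k m : ℕ) : (Coarse d L k m → ℂ) →ₗ[ℂ] (Fine d L m → ℂ) where
  toFun h x := h (blockLabel x)
  map_add' _ _ := rfl
  map_smul' _ _ := rfl

theorem mem_block_iff {d L k m : ℕ} (hL : 0 < L) (z : Coarse d L k m) (x : Fine d L m) :
    x ∈ block z ↔ blockLabel x = z := by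
  have hpos : 0 < L ^ k := pow_pos hL k
  simp only [block, Finset.mem_filter, Finset.mem_univ, true_and, blockLabel, funext_iff,
    Fin.ext_iff]
  refine forall_congr' fun i => ?_
  rw [Nat.div_eq_iff hpos, mul_comm (z i : ℕ)]
  omega

/-- `averagingAdjoint` is the adjoint of `averaging` for the scalar products of `ℒ²(Ω_k)` and
`ℒ²(Ω)`, whose lattice spacings are `1` and `L ^ (-k)`. -/
theorem latticeInner_averaging (d L k m : ℕ) (hL : 0 < L) (h : Coarse d L k m → ℂ)
    (f : Fine d L m → ℂ) :
    latticeInner d 1 h (averaging d L k m f) =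
      latticeInner d (spacing L k) (averagingAdjoint d L k m h) f := by
  simp only [latticeInner, averaging, averagingAdjoint, LinearMap.coe_mk, AddHom.coe_mk, spacing]
  have hb : ∀ z : Coarse d L k m, (block z : Finset (Fine d L m)) =
      Finset.univ.filter fun x => blockLabel x = z := by
    intro z
    ext x
    simp [mem_block_iff hL]
  have key : ∑ z : Coarse d L k m, conj (h z) * ∑ x ∈ block z, f x =
      ∑ x : Fine d L m, conj (h (blockLabel x)) * f x := by
    rw [← Finset.sum_fiberwise (s := Finset.univ)
      (g := fun x : Fine d L m => (blockLabel x : Coarse d L k m))]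
    refine Finset.sum_congr rfl fun z _ => ?_
    rw [hb z, Finset.mul_sum]
    refine Finset.sum_congr rfl fun x hx => ?_
    rw [(Finset.mem_filter.mp hx).2]
  rw [← key, Finset.mul_sum, Finset.mul_sum]
  refine Finset.sum_congr rfl fun z _ => ?_
  push_cast
  rw [inv_pow, ← pow_mul]
  ring

/-- The sequence `a_j = a (1 - L ^ (-2)) / (1 - L ^ (-2 j))`, `j = 1, 2, …`, which solves `a_1 = a`,
`a_{j+1} = a a_j / (a L ^ (-2) + a_j)`. -/
def aCoeff (a : ℝ) (L j : ℕ) : ℝ :=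
  a * (1 - ((L : ℝ) ^ 2)⁻¹) / (1 - ((L : ℝ) ^ (2 * j))⁻¹)

/-- The operator `-Δ_Ω + μ_k + a_k Q_{Ω,k}^* Q_{Ω,k}` on `ℒ²(Ω)`, with `μ_k = L ^ (2k) μ₀`. -/
def greenOperator (d : ℕ) (a μ₀ : ℝ) (L k m : ℕ) : Module.End ℂ (Fine d L m → ℂ) :=
  -neumannLaplacian d (spacing L k) (L ^ m)
    + (((L : ℝ) ^ (2 * k) * μ₀ : ℝ) : ℂ) • LinearMap.id
    + ((aCoeff a L k : ℝ) : ℂ) • (averagingAdjoint d L k m ∘ₗ averaging d L k m)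

/-- The propagator `G_k(Ω) = (-Δ_Ω + μ_k + a_k Q_{Ω,k}^* Q_{Ω,k})⁻¹`; `Ring.inverse` is the inverse
of an invertible operator. -/
def greenFunction (d : ℕ) (a μ₀ : ℝ) (L k m : ℕ) : Module.End ℂ (Fine d L m → ℂ) :=
  Ring.inverse (greenOperator d a μ₀ L k m)

/-- The operator `G_k(Ω) Q_{Ω,k}^* : ℒ²(Ω_k) → ℒ²(Ω)`. -/
def greenAveragingAdjoint (d : ℕ) (a μ₀ : ℝ) (L k m : ℕ) :
    (Coarse d L k m → ℂ) →ₗ[ℂ] (Fine d L m → ℂ) :=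
  greenFunction d a μ₀ L k m ∘ₗ averagingAdjoint d L k m

/-- The operator `ℋ_k(Ω) = a_k G_k(Ω) Q_{Ω,k}^*`. -/
def hOperator (d : ℕ) (a μ₀ : ℝ) (L k m : ℕ) :
    (Coarse d L k m → ℂ) →ₗ[ℂ] (Fine d L m → ℂ) :=
  ((aCoeff a L k : ℝ) : ℂ) • greenAveragingAdjoint d a μ₀ L k m

end LatticeGreen

end

/-!
The kernel of `G_k Q^*` at `(x, y)` is the value at `x` of the solution `u` of
`(-Δ + ν + b Q^* Q) u = 1_{B(y)}`, where `B(y)` is a unit block and `b = a_k` lies between `3 a / 4`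
and `a`. All operators have real matrix entries, so it suffices to study real matrices, ordered by
positive semidefiniteness. Write `N = L ^ k` for the inverse lattice spacing.

*Spectral gap.* On an interval, `1 ≤ 4 (-Δ_I) + 4 q` by Poincaré's inequality on unit blocks, where
`0 ≤ q ≤ 1` is the one-dimensional `Q^* Q`; the end point, which forms a block with a single site,
is compared with the neighbouring block. Since `Q^* Q` is the tensor product of the `q`, using this
in one coordinate after the other gives `1 ≤ 4 ^ d (-Δ + Q^* Q)`
(`one_le_cubeMatrix_add_cubeBlockMatrix`).

*Weighted `ℓ²` bound.* By the Combes–Thomas argument (`sum_weighted_sq_le`), conjugation with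
`exp (α |x - y|₁)` changes the quadratic form by at most `O(α²)`, uniformly in `N`. With the gap
this gives `∑ x, exp (2 α |x - y|₁) u x ^ 2 ≤ C N ^ d`. In particular the block averages of `u` decay
exponentially, so that `(1 + ν - Δ) u = g + u` with a pointwise exponentially decaying `g`.

*From `ℓ²` to pointwise.* Let `R = (1 + ν - Δ)⁻¹` and iterate:
`u = ∑_{j < d} R ^ (j + 1) g + R ^ d u`.
By the minimum principle `R` has nonnegative entries, and with the supersolution
`∏ cosh (β (x_μ - c_μ))` the rows of `R ^ n` are summable against `exp (β |x - z|₁)`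
(`sum_massiveMatrix_inv_pow_mul_exp_le`); this settles the terms with `g`. For the last term the
entries of `R ^ d` have to be at most `(2 / N) ^ d` (`abs_massiveMatrix_inv_pow_apply_le`). Indeed
the one-dimensional Sobolev inequality reads `e_t e_tᵀ ≤ (2 / N) (1 - Δ_I)`, its tensor product
bounds `e_x e_xᵀ` by `(2 / N) ^ d ∏ (1 - Δ_μ)`, and `∏ (1 - Δ_μ) ≤ (1 + ν - Δ) ^ d` because the
factors commute. The Cauchy–Schwarz inequality then turns the weighted `ℓ²` bound into a pointwise
one (`abs_massiveMatrix_inv_pow_mulVec_le_of_sq`).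
-/

open scoped MatrixOrder Matrix

set_option linter.unusedSectionVars false

noncomputable section

namespace LatticeGreen

/-! ### Tensor products of matrices and their order -/

section Tensor

variable {ι κ : Type*} [Fintype ι] [DecidableEq ι] [Fintype κ] [DecidableEq κ]

/-- The tensor product `⨂ μ, M μ` of square matrices, acting on functions of `ι → κ`. -/
def tensor (M : ι → Matrix κ κ ℝ) : Matrix (ι → κ) (ι → κ) ℝ :=
  Matrix.of fun x x' => ∏ μ, M μ (x μ) (x' μ)

theorem tensor_apply (M : ι → Matrix κ κ ℝ) (x x' : ι → κ) :
    tensor M x x' = ∏ μ, M μ (x μ) (x' μ) := rfl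

theorem tensor_mul (M N : ι → Matrix κ κ ℝ) :
    tensor M * tensor N = tensor fun μ => M μ * N μ := by
  ext x x'
  simp only [Matrix.mul_apply, tensor_apply, Fintype.prod_sum, Finset.prod_mul_distrib]

theorem tensor_one : tensor (fun _ : ι => (1 : Matrix κ κ ℝ)) = 1 := by
  ext x x'
  simp only [tensor_apply, Matrix.one_apply, funext_iff]
  split_ifs with h
  · simp [h]
  · push Not at h
    obtain ⟨μ, hμ⟩ := h
    exact Finset.prod_eq_zero (Finset.mem_univ μ) (by simp [hμ])

/-- If `M μ = (C μ)ᵀ * C μ`, then `tensor M = (tensor C)ᵀ * tensor C`. -/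
theorem tensor_nonneg {M : ι → Matrix κ κ ℝ} (hM : ∀ μ, 0 ≤ M μ) : 0 ≤ tensor M := by
  choose C hC using fun μ => CStarAlgebra.nonneg_iff_eq_star_mul_self.mp (hM μ)
  have h : tensor M = star (tensor C) * tensor C := by
    have : star (tensor C) = tensor fun μ => star (C μ) := by
      ext x x'
      simp [Matrix.star_eq_conjTranspose, tensor_apply]
    rw [this, tensor_mul]
    exact congrArg tensor (funext hC)
  rw [h]
  exact star_mul_self_nonneg _

theorem tensor_add (M N : ι → Matrix κ κ ℝ) :
    tensor (fun μ => M μ + N μ) =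
      ∑ t ∈ (Finset.univ : Finset ι).powerset, tensor fun μ => if μ ∈ t then M μ else N μ := by
  ext x x'
  simp only [Matrix.sum_apply, tensor_apply, Matrix.add_apply, Finset.prod_add]
  refine Finset.sum_congr rfl fun t _ => ?_
  rw [← Finset.prod_sdiff (Finset.subset_univ t), mul_comm]
  congr 1
  · exact Finset.prod_congr rfl fun μ hμ => by rw [if_neg (Finset.mem_sdiff.mp hμ).2]
  · exact Finset.prod_congr rfl fun μ hμ => by rw [if_pos hμ]

/-- The difference is a sum of tensor products of the nonnegative matrices `M μ` and `N μ - M μ`. -/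
theorem tensor_mono {M N : ι → Matrix κ κ ℝ} (hM : ∀ μ, 0 ≤ M μ) (hMN : ∀ μ, M μ ≤ N μ) :
    tensor M ≤ tensor N := by
  have hN : N = fun μ => M μ + (N μ - M μ) := by simp
  rw [hN, tensor_add]
  have hterm : ∀ t ∈ (Finset.univ : Finset ι).powerset,
      0 ≤ tensor fun μ => if μ ∈ t then M μ else N μ - M μ := fun t _ =>
    tensor_nonneg fun μ => by
      split_ifs
      · exact hM μ
      · exact sub_nonneg.mpr (hMN μ)
  have h := Finset.single_le_sum hterm (Finset.mem_powerset_self Finset.univ)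
  simpa using h

theorem tensor_commute {M N : ι → Matrix κ κ ℝ} (h : ∀ μ, Commute (M μ) (N μ)) :
    Commute (tensor M) (tensor N) := by
  rw [Commute, SemiconjBy, tensor_mul, tensor_mul]
  exact congrArg tensor (funext h)

/-- The matrix `1 ⊗ ⋯ ⊗ b ⊗ ⋯ ⊗ 1` with `b` at position `μ`. -/
def lift (μ : ι) (b : Matrix κ κ ℝ) : Matrix (ι → κ) (ι → κ) ℝ :=
  tensor (Function.update (fun _ => 1) μ b)

theorem lift_apply (μ : ι) (b : Matrix κ κ ℝ) (x x' : ι → κ) :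
    lift μ b x x' = b (x μ) (x' μ) * ∏ ν ∈ Finset.univ.erase μ,
      (1 : Matrix κ κ ℝ) (x ν) (x' ν) := by
  rw [lift, tensor_apply, ← Finset.mul_prod_erase _ _ (Finset.mem_univ μ),
    Function.update_self]
  congr 1
  refine Finset.prod_congr rfl fun ν hν => ?_
  rw [Function.update_of_ne (Finset.ne_of_mem_erase hν)]

theorem lift_mulVec (μ : ι) (b : Matrix κ κ ℝ) (f : (ι → κ) → ℝ) (x : ι → κ) :
    (lift μ b *ᵥ f) x = ∑ t, b (x μ) t * f (Function.update x μ t) := by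
  rw [Matrix.mulVec, dotProduct]
  symm
  refine Fintype.sum_of_injective (fun t => Function.update x μ t)
    (Function.update_injective x μ) _ _ ?_ ?_
  · intro x' hx'
    rw [lift_apply]
    obtain ⟨ν, hν, hne⟩ : ∃ ν, ν ≠ μ ∧ x ν ≠ x' ν := by
      by_contra! h
      refine hx' ⟨x' μ, ?_⟩
      funext ν
      by_cases hν : ν = μ
      · subst hν; simp
      · simp [Function.update_of_ne hν, h ν hν]
    have h0 : ∏ ν ∈ Finset.univ.erase μ, (1 : Matrix κ κ ℝ) (x ν) (x' ν) = 0 :=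
      Finset.prod_eq_zero (Finset.mem_erase.mpr ⟨hν, Finset.mem_univ ν⟩) (Matrix.one_apply_ne hne)
    rw [h0, mul_zero, zero_mul]
  · intro t
    rw [lift_apply, Finset.prod_eq_one, Function.update_self, mul_one]
    intro ν hν
    rw [Function.update_of_ne (Finset.ne_of_mem_erase hν), Matrix.one_apply_eq]

theorem lift_add (μ : ι) (b c : Matrix κ κ ℝ) : lift μ (b + c) = lift μ b + lift μ c := by
  ext x x'
  simp only [lift_apply, Matrix.add_apply, add_mul]

theorem lift_smul (μ : ι) (r : ℝ) (b : Matrix κ κ ℝ) : lift μ (r • b) = r • lift μ b := by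
  ext x x'
  simp only [lift_apply, Matrix.smul_apply, smul_eq_mul, mul_assoc]

theorem lift_one (μ : ι) : lift μ (1 : Matrix κ κ ℝ) = 1 := by
  rw [lift, Function.update_eq_self, tensor_one]

theorem lift_nonneg (μ : ι) {b : Matrix κ κ ℝ} (hb : 0 ≤ b) : 0 ≤ lift μ b := by
  refine tensor_nonneg fun ν => ?_
  by_cases h : ν = μ
  · subst h; simpa using hb
  · rw [Function.update_of_ne h]; exact zero_le_one

theorem tensor_mul_lift (M : ι → Matrix κ κ ℝ) (μ : ι) (b : Matrix κ κ ℝ) :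
    tensor M * lift μ b = tensor (Function.update M μ (M μ * b)) := by
  rw [lift, tensor_mul]
  congr 1
  funext ν
  by_cases h : ν = μ
  · subst h; simp
  · simp [Function.update_of_ne h]

theorem tensor_commute_lift {M : ι → Matrix κ κ ℝ} {μ : ι} {b : Matrix κ κ ℝ}
    (h : Commute (M μ) b) : Commute (tensor M) (lift μ b) := by
  refine tensor_commute fun ν => ?_
  by_cases hν : ν = μ
  · subst hν; simpa using h
  · rw [Function.update_of_ne hν]; exact Commute.one_right _

theorem abs_lift_apply (μ : ι) (b : Matrix κ κ ℝ) (x x' : ι → κ) :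
    |lift μ b x x'| = lift μ (b.map abs) x x' := by
  rw [lift_apply, lift_apply, abs_mul, Matrix.map_apply]
  congr 1
  refine abs_of_nonneg (Finset.prod_nonneg fun ν _ => ?_)
  rw [Matrix.one_apply]
  positivity

theorem tensor_smul (r : ℝ) (M : ι → Matrix κ κ ℝ) :
    tensor (fun μ => r • M μ) = r ^ Fintype.card ι • tensor M := by
  ext x x'
  simp [tensor_apply, Finset.prod_mul_distrib]

end Tensor

/-! ### Positive semidefinite real matrices -/

section Psd

variable {X : Type*} [Fintype X] [DecidableEq X]

theorem psd_nonneg_iff {B : Matrix X X ℝ} (hB : B.IsSymm) :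
    0 ≤ B ↔ ∀ f : X → ℝ, 0 ≤ f ⬝ᵥ (B *ᵥ f) := by
  rw [Matrix.nonneg_iff_posSemidef, Matrix.posSemidef_iff_dotProduct_mulVec]
  simp [Matrix.IsHermitian, Matrix.conjTranspose_eq_transpose_of_trivial, hB.eq]

theorem psd_le_iff {B C : Matrix X X ℝ} (hB : B.IsSymm) (hC : C.IsSymm) :
    B ≤ C ↔ ∀ f : X → ℝ, f ⬝ᵥ (B *ᵥ f) ≤ f ⬝ᵥ (C *ᵥ f) := by
  rw [← sub_nonneg, psd_nonneg_iff (hC.sub hB)]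
  simp [Matrix.sub_mulVec, dotProduct_sub]

theorem dotProduct_mulVec_le {B C : Matrix X X ℝ} (h : B ≤ C) (f : X → ℝ) :
    f ⬝ᵥ (B *ᵥ f) ≤ f ⬝ᵥ (C *ᵥ f) := by
  have := (Matrix.le_iff.mp h).dotProduct_mulVec_nonneg f
  simpa [Matrix.sub_mulVec, dotProduct_sub] using this

theorem isSymm_of_nonneg {B : Matrix X X ℝ} (h : 0 ≤ B) : B.IsSymm := by
  have := (Matrix.nonneg_iff_posSemidef.mp h).1
  rwa [Matrix.IsHermitian, Matrix.conjTranspose_eq_transpose_of_trivial] at this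

theorem psd_smul_nonneg {B : Matrix X X ℝ} (h : 0 ≤ B) {r : ℝ} (hr : 0 ≤ r) : 0 ≤ r • B :=
  Matrix.nonneg_iff_posSemidef.mpr ((Matrix.nonneg_iff_posSemidef.mp h).smul hr)

theorem psd_smul_mono {B C : Matrix X X ℝ} (h : B ≤ C) {r : ℝ} (hr : 0 ≤ r) : r • B ≤ r • C := by
  rw [← sub_nonneg, ← smul_sub]
  exact psd_smul_nonneg (sub_nonneg.mpr h) hr

end Psd

/-! ### Poincaré and Sobolev inequalities on a discrete interval -/

section Sequences

theorem sq_sub_le_sum_sq (F : ℕ → ℝ) (b N : ℕ) {i j : ℕ} (hbi : b ≤ i) (hiN : i ≤ b + N)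
    (hbj : b ≤ j) (hjN : j ≤ b + N) :
    (F i - F j) ^ 2 ≤ N * ∑ e ∈ Finset.range N, (F (b + e + 1) - F (b + e)) ^ 2 := by
  wlog hij : j ≤ i generalizing i j
  · have := this hbj hjN hbi hiN (le_of_not_ge hij)
    rwa [← neg_sub, neg_sq] at this
  have hshift : ∑ e ∈ Finset.range N, (F (b + e + 1) - F (b + e)) ^ 2
      = ∑ e ∈ Finset.Ico b (b + N), (F (e + 1) - F e) ^ 2 := by
    rw [Finset.sum_Ico_eq_sum_range]
    simp
  rw [hshift, ← Finset.sum_Ico_sub F hij]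
  refine sq_sum_le_card_mul_sum_sq.trans ?_
  have hsub : Finset.Ico j i ⊆ Finset.Ico b (b + N) := Finset.Ico_subset_Ico hbj hiN
  have hcard : ((Finset.Ico j i).card : ℝ) ≤ N := by
    rw [Nat.card_Ico]
    exact_mod_cast (by omega : i - j ≤ N)
  exact mul_le_mul hcard (Finset.sum_le_sum_of_subset_of_nonneg hsub fun _ _ _ => sq_nonneg _)
    (Finset.sum_nonneg fun _ _ => sq_nonneg _) (by positivity)

theorem sum_range_mul (g : ℕ → ℝ) (N K : ℕ) :
    ∑ i ∈ Finset.range (N * K), g i =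
      ∑ z ∈ Finset.range K, ∑ r ∈ Finset.range N, g (N * z + r) := by
  induction K with
  | zero => simp
  | succ K ih => rw [mul_add, mul_one, Finset.sum_range_add, ih, Finset.sum_range_succ]

/-- A value is controlled by the mean over `N` consecutive sites and the gradient next to it. -/
theorem sq_le_mean_add_gradient (F : ℕ → ℝ) (b : ℕ) {N i : ℕ} (hN : 0 < N) (hbi : b ≤ i)
    (hiN : i ≤ b + N) :
    F i ^ 2 ≤ 2 * (((N : ℝ))⁻¹ * ∑ r ∈ Finset.range N, F (b + r)) ^ 2
      + 2 * (N * ∑ e ∈ Finset.range N, (F (b + e + 1) - F (b + e)) ^ 2) := by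
  have hN' : (N : ℝ) ≠ 0 := by positivity
  set D := N * ∑ e ∈ Finset.range N, (F (b + e + 1) - F (b + e)) ^ 2 with hD
  set m := ((N : ℝ))⁻¹ * ∑ r ∈ Finset.range N, F (b + r) with hm
  have hdiff : F i - m = (N : ℝ)⁻¹ * ∑ r ∈ Finset.range N, (F i - F (b + r)) := by
    rw [Finset.sum_sub_distrib, Finset.sum_const, Finset.card_range, nsmul_eq_mul, mul_sub,
      inv_mul_cancel_left₀ hN', hm]
  have hsq : (F i - m) ^ 2 ≤ D := by
    have h1 : (∑ r ∈ Finset.range N, (F i - F (b + r))) ^ 2 ≤ N * (N * D) := by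
      refine sq_sum_le_card_mul_sum_sq.trans ?_
      rw [Finset.card_range]
      refine mul_le_mul_of_nonneg_left ?_ (by positivity)
      calc ∑ r ∈ Finset.range N, (F i - F (b + r)) ^ 2 ≤ ∑ r ∈ Finset.range N, D :=
            Finset.sum_le_sum fun r hr => by
              have := Finset.mem_range.mp hr
              exact sq_sub_le_sum_sq F b N hbi hiN (by omega) (by omega)
        _ = N * D := by simp
    rw [hdiff, mul_pow]
    calc ((N : ℝ)⁻¹) ^ 2 * (∑ r ∈ Finset.range N, (F i - F (b + r))) ^ 2
        ≤ ((N : ℝ)⁻¹) ^ 2 * (N * (N * D)) := mul_le_mul_of_nonneg_left h1 (by positivity)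
      _ = D := by field_simp
  nlinarith [sq_nonneg (F i - 2 * m), sq_nonneg m]

theorem sum_gradient_le (F : ℕ → ℝ) {b N M : ℕ} (h : b + N ≤ M) :
    ∑ e ∈ Finset.range N, (F (b + e + 1) - F (b + e)) ^ 2 ≤
      ∑ e ∈ Finset.range M, (F (e + 1) - F e) ^ 2 := by
  have hshift : ∑ e ∈ Finset.range N, (F (b + e + 1) - F (b + e)) ^ 2
      = ∑ e ∈ Finset.Ico b (b + N), (F (e + 1) - F e) ^ 2 := by
    rw [Finset.sum_Ico_eq_sum_range]
    simp
  rw [hshift, Finset.range_eq_Ico]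
  exact Finset.sum_le_sum_of_subset_of_nonneg (Finset.Ico_subset_Ico (Nat.zero_le _) h)
    fun _ _ _ => sq_nonneg _

/-- Sobolev's inequality on an interval of length at least `1`, with lattice spacing `1 / N`. -/
theorem sobolev_sequence (F : ℕ → ℝ) {N K i : ℕ} (hN : 0 < N) (hK : 0 < K) (hi : i ≤ N * K) :
    F i ^ 2 ≤ 2 * (N : ℝ)⁻¹ * (∑ j ∈ Finset.range (N * K + 1), F j ^ 2
      + (N : ℝ) ^ 2 * ∑ e ∈ Finset.range (N * K), (F (e + 1) - F e) ^ 2) := by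
  have hN' : (N : ℝ) ≠ 0 := by positivity
  -- The end point `N * K` is attached to the block `K - 1`.
  obtain ⟨z, hz, hzi, hiz⟩ : ∃ z, z < K ∧ N * z ≤ i ∧ i ≤ N * z + N := by
    rcases hi.lt_or_eq with hlt | rfl
    · exact ⟨i / N, (Nat.div_lt_iff_lt_mul hN).mpr (by rwa [mul_comm] at hlt),
        Nat.mul_div_le i N, (Nat.lt_mul_div_succ i hN).le.trans (by rw [mul_add, mul_one])⟩
    · exact ⟨K - 1, by omega, Nat.mul_le_mul_left N (by omega), by
        rw [← Nat.mul_succ]; exact Nat.mul_le_mul_left N (by omega)⟩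
  have hle : N * z + N ≤ N * K := by
    rw [← Nat.mul_succ]; exact Nat.mul_le_mul_left N hz
  have h1 := sq_le_mean_add_gradient F (N * z) hN hzi hiz
  have h2 := sum_gradient_le F hle
  have h3 : (∑ r ∈ Finset.range N, F (N * z + r)) ^ 2 ≤
      N * ∑ j ∈ Finset.range (N * K + 1), F j ^ 2 := by
    refine sq_sum_le_card_mul_sum_sq.trans ?_
    rw [Finset.card_range]
    refine mul_le_mul_of_nonneg_left ?_ (by positivity)
    have : ∑ r ∈ Finset.range N, F (N * z + r) ^ 2 =
        ∑ j ∈ Finset.Ico (N * z) (N * z + N), F j ^ 2 := by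
      rw [Finset.sum_Ico_eq_sum_range]
      simp
    rw [this, Finset.range_eq_Ico]
    exact Finset.sum_le_sum_of_subset_of_nonneg
      (Finset.Ico_subset_Ico (Nat.zero_le _) (by omega)) fun _ _ _ => sq_nonneg _
  have h4 : ((N : ℝ)⁻¹ * ∑ r ∈ Finset.range N, F (N * z + r)) ^ 2 ≤
      (N : ℝ)⁻¹ * ∑ j ∈ Finset.range (N * K + 1), F j ^ 2 := by
    rw [mul_pow]
    refine (mul_le_mul_of_nonneg_left h3 (by positivity)).trans_eq ?_
    field_simp
  have h5 : (N : ℝ) * ∑ e ∈ Finset.range N, (F (N * z + e + 1) - F (N * z + e)) ^ 2 ≤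
      (N : ℝ)⁻¹ * ((N : ℝ) ^ 2 * ∑ e ∈ Finset.range (N * K), (F (e + 1) - F e) ^ 2) := by
    refine (mul_le_mul_of_nonneg_left h2 (by positivity)).trans_eq ?_
    field_simp
  linarith

/-- Poincaré's inequality for blocks of `N` sites, the site `N * K` being attached to the last
block. -/
theorem poincare_sequence (F : ℕ → ℝ) {N K : ℕ} (hN : 0 < N) (hK : 0 < K) :
    ∑ i ∈ Finset.range (N * K + 1), F i ^ 2 ≤
      4 * ((N : ℝ) ^ 2 * ∑ e ∈ Finset.range (N * K), (F (e + 1) - F e) ^ 2)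
      + 4 * ∑ z ∈ Finset.range K, (N : ℝ)⁻¹ * (∑ r ∈ Finset.range N, F (N * z + r)) ^ 2 := by
  have hN' : (N : ℝ) ≠ 0 := by positivity
  have hN1 : (1 : ℝ) ≤ N := by exact_mod_cast hN
  set S : ℕ → ℝ := fun z => 2 * (((N : ℝ))⁻¹ * ∑ r ∈ Finset.range N, F (N * z + r)) ^ 2
      + 2 * (N * ∑ e ∈ Finset.range N, (F (N * z + e + 1) - F (N * z + e)) ^ 2) with hS
  have hS0 : ∀ z, 0 ≤ S z := fun z => by
    have : 0 ≤ ∑ e ∈ Finset.range N, (F (N * z + e + 1) - F (N * z + e)) ^ 2 :=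
      Finset.sum_nonneg fun _ _ => sq_nonneg _
    simp only [hS]
    positivity
  have hbound : ∀ z, ∀ r ≤ N, F (N * z + r) ^ 2 ≤ S z := fun z r hr =>
    sq_le_mean_add_gradient F (N * z) hN (by omega) (by omega)
  have hlast : F (N * K) ^ 2 ≤ ∑ z ∈ Finset.range K, S z := by
    have h := hbound (K - 1) N le_rfl
    rw [← Nat.mul_succ, Nat.succ_eq_add_one, Nat.sub_add_cancel hK] at h
    exact h.trans (Finset.single_le_sum (fun z _ => hS0 z) (Finset.mem_range.mpr (by omega)))
  have hfull : ∑ i ∈ Finset.range (N * K), F i ^ 2 ≤ N * ∑ z ∈ Finset.range K, S z := by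
    rw [sum_range_mul, Finset.mul_sum]
    refine Finset.sum_le_sum fun z _ => ?_
    calc ∑ r ∈ Finset.range N, F (N * z + r) ^ 2 ≤ ∑ r ∈ Finset.range N, S z :=
          Finset.sum_le_sum fun r hr => hbound z r (Finset.mem_range.mp hr).le
      _ = N * S z := by simp
  have hsum0 : 0 ≤ ∑ z ∈ Finset.range K, S z := Finset.sum_nonneg fun z _ => hS0 z
  -- Each `S z` is used for the `N` sites of its block and perhaps once more for the end point.
  have hall : ∑ i ∈ Finset.range (N * K + 1), F i ^ 2 ≤ 2 * N * ∑ z ∈ Finset.range K, S z := by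
    rw [Finset.sum_range_succ]
    nlinarith
  refine hall.trans_eq ?_
  rw [sum_range_mul, Finset.mul_sum, Finset.mul_sum, Finset.mul_sum, Finset.mul_sum,
    ← Finset.sum_add_distrib]
  refine Finset.sum_congr rfl fun z _ => ?_
  simp only [hS]
  field_simp
  ring

end Sequences

/-! ### The Laplacian and the block projection of an interval -/

/-- The matrix of `-Δ_I` on `{0, …, M} / N`, with Neumann boundary conditions. -/
def intervalMatrix (N M : ℕ) : Matrix (Fin (M + 1)) (Fin (M + 1)) ℝ :=
  Matrix.of fun i j => (N : ℝ) ^ 2 * (2 * (if j = i then 1 else 0)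
    - (if j = nextSite i then 1 else 0) - (if j = prevSite i then 1 else 0))

/-- The matrix of `Q^* Q` on `{0, …, M} / N` in dimension one: sums over blocks of `N` sites,
divided by `N`. -/
def blockMatrix (N M : ℕ) : Matrix (Fin (M + 1)) (Fin (M + 1)) ℝ :=
  Matrix.of fun i j => if (j : ℕ) / N = (i : ℕ) / N then (N : ℝ)⁻¹ else 0

theorem intervalMatrix_mulVec (N M : ℕ) (f : Fin (M + 1) → ℝ) (i : Fin (M + 1)) :
    (intervalMatrix N M *ᵥ f) i = (N : ℝ) ^ 2 * (2 * f i - f (nextSite i) - f (prevSite i)) := by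
  simp only [Matrix.mulVec, dotProduct, intervalMatrix, Matrix.of_apply, mul_assoc, sub_mul,
    ite_mul, one_mul, zero_mul, Finset.sum_sub_distrib, ← Finset.mul_sum,
    Finset.sum_ite_eq', Finset.mem_univ, if_true]

/-- Summation by parts for the Neumann Laplacian. -/
theorem dotProduct_intervalMatrix (N M : ℕ) (f : Fin (M + 1) → ℝ) :
    f ⬝ᵥ (intervalMatrix N M *ᵥ f) =
      (N : ℝ) ^ 2 * ∑ e : Fin M, (f e.succ - f e.castSucc) ^ 2 := by
  have h1 : ∑ i, f i * (f i - f (nextSite i)) =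
      ∑ e : Fin M, f e.castSucc * (f e.castSucc - f e.succ) := by
    rw [Fin.sum_univ_castSucc]
    have hl : nextSite (Fin.last M) = Fin.last M := by ext; simp [nextSite]
    rw [hl, sub_self, mul_zero, add_zero]
    refine Finset.sum_congr rfl fun e _ => ?_
    have : nextSite e.castSucc = e.succ := by
      ext; simp [nextSite]
    rw [this]
  have h2 : ∑ i, f i * (f i - f (prevSite i)) =
      ∑ e : Fin M, f e.succ * (f e.succ - f e.castSucc) := by
    rw [Fin.sum_univ_succ]
    have hl : prevSite (0 : Fin (M + 1)) = 0 := by ext; simp [prevSite]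
    rw [hl, sub_self, mul_zero, zero_add]
    refine Finset.sum_congr rfl fun e _ => ?_
    have : prevSite e.succ = e.castSucc := by
      ext; simp [prevSite]
    rw [this]
  calc f ⬝ᵥ (intervalMatrix N M *ᵥ f)
      = (N : ℝ) ^ 2 * (∑ i, f i * (f i - f (nextSite i)) + ∑ i, f i * (f i - f (prevSite i))) := by
        rw [← Finset.sum_add_distrib, Finset.mul_sum]
        refine Finset.sum_congr rfl fun i _ => ?_
        rw [intervalMatrix_mulVec]
        ring
    _ = _ := by
        rw [h1, h2, ← Finset.sum_add_distrib]
        congr 1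
        exact Finset.sum_congr rfl fun e _ => by ring

theorem intervalMatrix_isSymm (N M : ℕ) : (intervalMatrix N M).IsSymm := by
  ext i j
  simp only [Matrix.transpose_apply, intervalMatrix, Matrix.of_apply, nextSite, prevSite,
    Fin.ext_iff]
  congr 1
  have hi := i.isLt
  have hj := j.isLt
  split_ifs <;> first | omega | norm_num

theorem intervalMatrix_nonneg (N M : ℕ) : 0 ≤ intervalMatrix N M := by
  rw [psd_nonneg_iff (intervalMatrix_isSymm N M)]
  intro f
  rw [dotProduct_intervalMatrix]
  exact mul_nonneg (by positivity) (Finset.sum_nonneg fun _ _ => sq_nonneg _)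

theorem blockMatrix_isSymm (N M : ℕ) : (blockMatrix N M).IsSymm := by
  ext i j
  simp only [Matrix.transpose_apply, blockMatrix, Matrix.of_apply, eq_comm]

theorem div_lt_of_fin {N K : ℕ} (i : Fin (N * K + 1)) : (i : ℕ) / N < K + 1 := by
  rcases Nat.eq_zero_or_pos N with rfl | hN
  · simp
  · exact Nat.lt_succ_of_le (Nat.div_le_of_le_mul (Nat.lt_succ_iff.mp i.isLt))

/-- The last block, with label `K`, consists of the single site `N * K`. -/
theorem dotProduct_blockMatrix (N K : ℕ) (f : Fin (N * K + 1) → ℝ) :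
    f ⬝ᵥ (blockMatrix N (N * K) *ᵥ f) = ∑ z ∈ Finset.range (K + 1),
      (N : ℝ)⁻¹ * (∑ i ∈ {i : Fin (N * K + 1) | (i : ℕ) / N = z}, f i) ^ 2 := by
  rw [dotProduct, ← Finset.sum_fiberwise_of_maps_to (s := Finset.univ)
    (t := Finset.range (K + 1)) (g := fun i : Fin (N * K + 1) => (i : ℕ) / N)
    fun i _ => Finset.mem_range.mpr (div_lt_of_fin i)]
  refine Finset.sum_congr rfl fun z _ => ?_
  rw [sq, Finset.sum_mul, Finset.mul_sum]
  refine Finset.sum_congr rfl fun i hi => ?_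
  have hi := (Finset.mem_filter.mp hi).2
  simp only [Matrix.mulVec, dotProduct, blockMatrix, Matrix.of_apply, ite_mul, zero_mul, hi]
  rw [← Finset.sum_filter, ← Finset.mul_sum]
  ring

theorem blockMatrix_nonneg (N K : ℕ) : 0 ≤ blockMatrix N (N * K) := by
  rw [psd_nonneg_iff (blockMatrix_isSymm _ _)]
  intro f
  rw [dotProduct_blockMatrix]
  exact Finset.sum_nonneg fun _ _ => by positivity

theorem card_block_le {N M : ℕ} (hN : 0 < N) (z : ℕ) :
    (Finset.univ.filter fun i : Fin (M + 1) => (i : ℕ) / N = z).card ≤ N := by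
  have : ((Finset.univ.filter fun i : Fin (M + 1) => (i : ℕ) / N = z).map
      Fin.valEmbedding) ⊆ Finset.Ico (N * z) (N * z + N) := by
    intro j hj
    obtain ⟨i, hi, rfl⟩ := Finset.mem_map.mp hj
    have hi := (Finset.mem_filter.mp hi).2
    rw [Finset.mem_Ico, Fin.valEmbedding_apply, ← hi]
    exact ⟨Nat.mul_div_le _ _, by
      have := Nat.lt_mul_div_succ (i : ℕ) hN
      rwa [mul_add, mul_one] at this⟩
  have h := Finset.card_le_card this
  simpa using h

theorem blockMatrix_le_one {N : ℕ} (hN : 0 < N) (K : ℕ) : blockMatrix N (N * K) ≤ 1 := by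
  rw [psd_le_iff (blockMatrix_isSymm _ _) Matrix.isSymm_one]
  intro f
  rw [dotProduct_blockMatrix, Matrix.one_mulVec, dotProduct,
    ← Finset.sum_fiberwise_of_maps_to (s := Finset.univ)
    (t := Finset.range (K + 1)) (g := fun i : Fin (N * K + 1) => (i : ℕ) / N)
    fun i _ => Finset.mem_range.mpr (div_lt_of_fin i)]
  refine Finset.sum_le_sum fun z _ => ?_
  have hN' : (0 : ℝ) < N := by exact_mod_cast hN
  rw [inv_mul_le_iff₀ hN']
  refine sq_sum_le_card_mul_sum_sq.trans ?_
  simp only [← sq]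
  exact mul_le_mul_of_nonneg_right (by exact_mod_cast card_block_le hN z)
    (Finset.sum_nonneg fun _ _ => sq_nonneg _)

/-- The extension of a function on `{0, …, M}` to `ℕ` by its last value. -/
def extendNat {M : ℕ} (f : Fin (M + 1) → ℝ) (n : ℕ) : ℝ :=
  f ⟨min n M, Nat.lt_succ_of_le (min_le_right _ _)⟩

theorem extendNat_of_lt {M : ℕ} (f : Fin (M + 1) → ℝ) {n : ℕ} (hn : n < M + 1) :
    extendNat f n = f ⟨n, hn⟩ := by
  unfold extendNat
  congr 2
  omega

theorem sum_sq_eq_extendNat {M : ℕ} (f : Fin (M + 1) → ℝ) :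
    f ⬝ᵥ f = ∑ i ∈ Finset.range (M + 1), extendNat f i ^ 2 := by
  rw [← Fin.sum_univ_eq_sum_range (fun i => extendNat f i ^ 2), dotProduct]
  exact Finset.sum_congr rfl fun i _ => by rw [extendNat_of_lt f i.isLt, sq]

theorem dotProduct_intervalMatrix_extendNat (N M : ℕ) (f : Fin (M + 1) → ℝ) :
    f ⬝ᵥ (intervalMatrix N M *ᵥ f) =
      (N : ℝ) ^ 2 * ∑ e ∈ Finset.range M, (extendNat f (e + 1) - extendNat f e) ^ 2 := by
  rw [← Fin.sum_univ_eq_sum_range (fun e => (extendNat f (e + 1) - extendNat f e) ^ 2),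
    dotProduct_intervalMatrix]
  congr 1
  refine Finset.sum_congr rfl fun e _ => ?_
  rw [extendNat_of_lt f (by omega : (e : ℕ) + 1 < M + 1),
    extendNat_of_lt f (by omega : (e : ℕ) < M + 1)]
  rfl

theorem sum_block_eq_extendNat {N K z : ℕ} (hN : 0 < N) (hz : z < K) (f : Fin (N * K + 1) → ℝ) :
    ∑ i ∈ {i : Fin (N * K + 1) | (i : ℕ) / N = z}, f i =
      ∑ r ∈ Finset.range N, extendNat f (N * z + r) := by
  have hle : N * z + N ≤ N * K := by
    rw [← Nat.mul_succ]; exact Nat.mul_le_mul_left N hz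
  symm
  refine Finset.sum_bij' (fun r hr => ⟨N * z + r, by have := Finset.mem_range.mp hr; omega⟩)
    (fun i _ => (i : ℕ) % N) ?_ ?_ ?_ ?_ ?_
  · intro r hr
    have := Finset.mem_range.mp hr
    simp [Nat.mul_add_div hN, Nat.div_eq_of_lt this]
  · intro i _
    exact Finset.mem_range.mpr (Nat.mod_lt _ hN)
  · intro r hr
    simp [Nat.mod_eq_of_lt (Finset.mem_range.mp hr)]
  · intro i hi
    have hi := (Finset.mem_filter.mp hi).2
    ext
    simp only [← hi, Nat.div_add_mod]
  · intro r hr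
    exact extendNat_of_lt f _

/-- Poincaré's inequality on unit blocks. -/
theorem one_le_intervalMatrix_add_blockMatrix {N K : ℕ} (hN : 0 < N) (hK : 0 < K) :
    1 ≤ (4 : ℝ) • intervalMatrix N (N * K) + (4 : ℝ) • blockMatrix N (N * K) := by
  rw [psd_le_iff Matrix.isSymm_one
    (((intervalMatrix_isSymm _ _).smul _).add ((blockMatrix_isSymm _ _).smul _))]
  intro f
  rw [Matrix.one_mulVec, Matrix.add_mulVec, Matrix.smul_mulVec, Matrix.smul_mulVec,
    dotProduct_add, dotProduct_smul, dotProduct_smul, sum_sq_eq_extendNat,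
    dotProduct_intervalMatrix_extendNat, dotProduct_blockMatrix, smul_eq_mul, smul_eq_mul]
  refine (poincare_sequence (extendNat f) hN hK).trans ?_
  gcongr
  rw [Finset.sum_range_succ]
  refine le_add_of_le_of_nonneg (le_of_eq (Finset.sum_congr rfl fun z hz => ?_)) (by positivity)
  rw [sum_block_eq_extendNat hN (Finset.mem_range.mp hz)]

/-- Sobolev's inequality: evaluation at a site is bounded by the `H¹` norm. -/
theorem single_le_one_add_intervalMatrix {N K : ℕ} (hN : 0 < N) (hK : 0 < K)
    (t : Fin (N * K + 1)) :
    Matrix.single t t (1 : ℝ) ≤ (2 * (N : ℝ)⁻¹) • (1 + intervalMatrix N (N * K)) := by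
  rw [psd_le_iff (by simp [Matrix.IsSymm])
    ((Matrix.isSymm_one.add (intervalMatrix_isSymm _ _)).smul _)]
  intro f
  have h := sobolev_sequence (extendNat f) hN hK (Nat.lt_succ_iff.mp t.isLt)
  rw [extendNat_of_lt f t.isLt] at h
  rw [Matrix.smul_mulVec, Matrix.add_mulVec, Matrix.one_mulVec, dotProduct_smul, dotProduct_add,
    sum_sq_eq_extendNat, dotProduct_intervalMatrix_extendNat, smul_eq_mul]
  refine le_of_eq_of_le ?_ h
  simp [Matrix.single_mulVec, dotProduct, Function.update_apply, sq]

theorem single_nonneg {X : Type*} [Fintype X] [DecidableEq X] (t : X) :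
    0 ≤ Matrix.single t t (1 : ℝ) := by
  rw [psd_nonneg_iff (by simp [Matrix.IsSymm])]
  intro f
  simp [Matrix.single_mulVec, dotProduct, Function.update_apply, mul_self_nonneg]

/-! ### Operator inequalities on the cube -/

/-- The matrix of `-Δ` on the cube `({0, …, M} / N) ^ d`, with Neumann boundary conditions. -/
def cubeMatrix (d N M : ℕ) : Matrix (Fin d → Fin (M + 1)) (Fin d → Fin (M + 1)) ℝ :=
  ∑ μ, lift μ (intervalMatrix N M)

/-- The matrix of `Q^* Q` on the cube. -/
def cubeBlockMatrix (d N M : ℕ) : Matrix (Fin d → Fin (M + 1)) (Fin d → Fin (M + 1)) ℝ :=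
  tensor fun _ => blockMatrix N M

theorem cubeMatrix_nonneg (d N M : ℕ) : 0 ≤ cubeMatrix d N M :=
  Finset.sum_nonneg fun μ _ => lift_nonneg μ (intervalMatrix_nonneg N M)

theorem cubeBlockMatrix_nonneg (d N K : ℕ) : 0 ≤ cubeBlockMatrix d N (N * K) :=
  tensor_nonneg fun _ => blockMatrix_nonneg N K

/-- The one-dimensional Poincaré inequality is used in one coordinate after the other, the factors
`blockMatrix` already present being at most `1`. -/
theorem one_le_sum_lift_add_tensor {d N K : ℕ} (hN : 0 < N) (hK : 0 < K) (s : Finset (Fin d)) :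
    1 ≤ (4 : ℝ) ^ s.card • (∑ μ ∈ s, lift μ (intervalMatrix N (N * K)) +
      tensor fun μ => if μ ∈ s then blockMatrix N (N * K) else 1) := by
  induction s using Finset.induction_on with
  | empty => simp [tensor_one]
  | insert ν s hν ih =>
    set A := intervalMatrix N (N * K)
    set q := blockMatrix N (N * K) with hq
    set X : Matrix (Fin d → Fin (N * K + 1)) (Fin d → Fin (N * K + 1)) ℝ :=
      tensor fun μ => if μ ∈ s then q else 1 with hX
    have hfac0 : ∀ μ, 0 ≤ if μ ∈ s then q else 1 := fun μ => by
      split_ifs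
      · exact blockMatrix_nonneg N K
      · exact zero_le_one
    have hstep : X ≤ (4 : ℝ) • lift ν A +
        (4 : ℝ) • tensor fun μ => if μ ∈ insert ν s then q else 1 := by
      have h1 : X ≤ tensor (Function.update (fun μ => if μ ∈ s then q else 1) ν
          ((4 : ℝ) • A + (4 : ℝ) • q)) := by
        refine tensor_mono hfac0 fun μ => ?_
        by_cases h : μ = ν
        · subst h
          simpa [hν] using one_le_intervalMatrix_add_blockMatrix hN hK
        · rw [Function.update_of_ne h]
      have h2 : tensor (Function.update (fun μ => if μ ∈ s then q else 1) ν
          ((4 : ℝ) • A + (4 : ℝ) • q)) = (4 : ℝ) • (X * lift ν A) +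
          (4 : ℝ) • tensor fun μ => if μ ∈ insert ν s then q else 1 := by
        have : ∀ b : Matrix (Fin (N * K + 1)) (Fin (N * K + 1)) ℝ,
            tensor (Function.update (fun μ => if μ ∈ s then q else 1) ν b) = X * lift ν b := by
          intro b
          rw [hX, tensor_mul_lift]
          simp [hν]
        rw [this, lift_add, lift_smul, lift_smul, mul_add, mul_smul_comm, mul_smul_comm, ← this q]
        congr 3
        funext μ
        by_cases h : μ = ν
        · subst h; simp
        · simp [h]
      have h3 : X * lift ν A ≤ lift ν A := by
        rw [hX, tensor_mul_lift]
        refine tensor_mono (fun μ => ?_) fun μ => ?_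
        · by_cases h : μ = ν
          · subst h
            simpa [hν] using intervalMatrix_nonneg N (N * K)
          · rw [Function.update_of_ne h]; exact hfac0 μ
        · by_cases h : μ = ν
          · subst h; simp [hν]
          · rw [Function.update_of_ne h, Function.update_of_ne h]
            split_ifs
            · exact blockMatrix_le_one hN K
            · exact le_rfl
      rw [h2] at h1
      exact h1.trans (add_le_add_left (psd_smul_mono h3 (by norm_num)) _)
    have hsum0 : 0 ≤ ∑ μ ∈ s, lift μ A :=
      Finset.sum_nonneg fun μ _ => lift_nonneg μ (intervalMatrix_nonneg N (N * K))
    rw [Finset.card_insert_of_notMem hν, Finset.sum_insert hν, pow_succ, mul_smul]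
    refine ih.trans (psd_smul_mono ?_ (by positivity))
    rw [smul_add, smul_add]
    have h4 : ∑ μ ∈ s, lift μ A ≤ (4 : ℝ) • ∑ μ ∈ s, lift μ A := by
      have h5 := psd_smul_nonneg hsum0 (by norm_num : (0 : ℝ) ≤ 3)
      have h6 : (4 : ℝ) • ∑ μ ∈ s, lift μ A = ∑ μ ∈ s, lift μ A + (3 : ℝ) • ∑ μ ∈ s, lift μ A := by
        rw [show (4 : ℝ) = 1 + 3 by norm_num, add_smul, one_smul]
      rw [h6]
      exact le_add_of_nonneg_right h5
    refine (add_le_add h4 hstep).trans_eq ?_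
    abel

/-- The spectral gap of `-Δ + Q^* Q`, uniform in the lattice spacing and in the volume. -/
theorem one_le_cubeMatrix_add_cubeBlockMatrix (d : ℕ) {N K : ℕ} (hN : 0 < N) (hK : 0 < K) :
    1 ≤ (4 : ℝ) ^ d • (cubeMatrix d N (N * K) + cubeBlockMatrix d N (N * K)) := by
  simpa [cubeMatrix, cubeBlockMatrix] using one_le_sum_lift_add_tensor (d := d) hN hK Finset.univ

/-- The matrix of `1 + ν - Δ`. -/
def massiveMatrix (d N M : ℕ) (ν : ℝ) : Matrix (Fin d → Fin (M + 1)) (Fin d → Fin (M + 1)) ℝ :=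
  (1 + ν) • 1 + cubeMatrix d N M

theorem lift_commute_cubeMatrix {d N M : ℕ} (μ : Fin d) :
    Commute (lift μ (intervalMatrix N M)) (cubeMatrix d N M) := by
  refine Commute.sum_right _ _ _ fun ν _ => tensor_commute_lift ?_
  by_cases h : ν = μ
  · subst h; simp
  · rw [Function.update_of_ne h]; exact Commute.one_left _

theorem one_psd_nonneg {X : Type*} [Fintype X] [DecidableEq X] : 0 ≤ (1 : Matrix X X ℝ) :=
  zero_le_one

theorem one_le_massiveMatrix (d N M : ℕ) {ν : ℝ} (hν : 0 ≤ ν) : 1 ≤ massiveMatrix d N M ν := by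
  have h1 : massiveMatrix d N M ν = 1 + (ν • 1 + cubeMatrix d N M) := by
    rw [massiveMatrix, add_smul, one_smul, add_assoc]
  rw [h1]
  exact le_add_of_nonneg_right
    (add_nonneg (psd_smul_nonneg one_psd_nonneg hν) (cubeMatrix_nonneg d N M))

theorem lift_one_add_le_massiveMatrix {d N M : ℕ} {ν : ℝ} (hν : 0 ≤ ν) (μ : Fin d) :
    lift μ (1 + intervalMatrix N M) ≤ massiveMatrix d N M ν := by
  rw [lift_add, lift_one, massiveMatrix, add_smul, one_smul]
  refine add_le_add (le_add_of_nonneg_right (psd_smul_nonneg one_psd_nonneg hν)) ?_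
  exact Finset.single_le_sum (f := fun μ => lift μ (intervalMatrix N M))
    (fun μ _ => lift_nonneg μ (intervalMatrix_nonneg N M)) (Finset.mem_univ μ)

/-- Both sides are products of commuting nonnegative matrices, with `1 + A_μ` on the left where the
right-hand side has the larger factor `1 + ν + ∑ A_μ`. -/
theorem tensor_le_massiveMatrix_pow {d N M : ℕ} {ν : ℝ} (hν : 0 ≤ ν) (s : Finset (Fin d)) :
    (tensor fun μ => if μ ∈ s then 1 + intervalMatrix N M else 1) ≤
      massiveMatrix d N M ν ^ s.card := by
  induction s using Finset.induction_on with
  | empty => simp [tensor_one]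
  | insert μ s hμ ih =>
    set S := massiveMatrix d N M ν with hS
    set P : Matrix (Fin d → Fin (M + 1)) (Fin d → Fin (M + 1)) ℝ :=
      tensor fun ρ => if ρ ∈ s then 1 + intervalMatrix N M else 1 with hP
    set B := lift μ (1 + intervalMatrix N M) with hB
    have hPB : (tensor fun ρ => if ρ ∈ insert μ s then 1 + intervalMatrix N M else 1) = P * B := by
      rw [hP, hB, tensor_mul_lift]
      congr 1
      funext ρ
      by_cases h : ρ = μ
      · subst h; simp [hμ]
      · simp [h]
    have hB0 : 0 ≤ B := lift_nonneg μ (add_nonneg zero_le_one (intervalMatrix_nonneg N M))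
    have hS0 : 0 ≤ S := zero_le_one.trans (one_le_massiveMatrix d N M hν)
    have hBS : Commute B S := by
      rw [hB, hS, massiveMatrix, lift_add, lift_one]
      exact ((Commute.one_left _).add_left
        (((Commute.one_right _).smul_right _).add_right (lift_commute_cubeMatrix μ)))
    have hBP : Commute P B := by
      rw [hP, hB]
      exact tensor_commute_lift (by simp [hμ])
    have hSn : ∀ n, 0 ≤ S ^ n := fun n => by
      rw [Matrix.nonneg_iff_posSemidef] at hS0 ⊢
      exact hS0.pow n
    have h1 : 0 ≤ S ^ s.card * (S - B) :=
      ((Commute.refl S).sub_right hBS.symm).pow_left _ |>.mul_nonneg (hSn _)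
        (sub_nonneg.mpr (lift_one_add_le_massiveMatrix hν μ))
    have h2 : 0 ≤ (S ^ s.card - P) * B :=
      ((hBS.symm.pow_left _).sub_left hBP).mul_nonneg (sub_nonneg.mpr ih) hB0
    rw [hPB, Finset.card_insert_of_notMem hμ, ← sub_nonneg]
    have : S ^ (s.card + 1) - P * B = S ^ s.card * (S - B) + (S ^ s.card - P) * B := by
      rw [pow_succ]; noncomm_ring
    rw [this]
    exact add_nonneg h1 h2

theorem single_eq_tensor {ι κ : Type*} [Fintype ι] [DecidableEq ι] [Fintype κ] [DecidableEq κ]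
    (x : ι → κ) :
    Matrix.single x x (1 : ℝ) = tensor fun μ => Matrix.single (x μ) (x μ) (1 : ℝ) := by
  ext y z
  simp only [tensor_apply, Matrix.single_apply]
  rw [Fintype.prod_ite_zero]
  simp [funext_iff, forall_and]

/-- Sobolev's inequality on the cube, in the form that the evaluation at a site is bounded in terms
of `(1 + ν - Δ) ^ d`. -/
theorem single_le_massiveMatrix_pow {d N K : ℕ} (hN : 0 < N) (hK : 0 < K) {ν : ℝ} (hν : 0 ≤ ν)
    (x : Fin d → Fin (N * K + 1)) :
    Matrix.single x x (1 : ℝ) ≤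
      (2 * (N : ℝ)⁻¹) ^ d • massiveMatrix d N (N * K) ν ^ d := by
  have h1 := tensor_le_massiveMatrix_pow (N := N) (M := N * K) hν (Finset.univ : Finset (Fin d))
  simp only [Finset.mem_univ, if_true, Finset.card_univ, Fintype.card_fin] at h1
  rw [single_eq_tensor]
  calc (tensor fun μ => Matrix.single (x μ) (x μ) (1 : ℝ))
      ≤ tensor fun _ => (2 * (N : ℝ)⁻¹) • (1 + intervalMatrix N (N * K)) :=
        tensor_mono (fun μ => single_nonneg (x μ))
          fun μ => single_le_one_add_intervalMatrix hN hK (x μ)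
    _ = (2 * (N : ℝ)⁻¹) ^ d • tensor fun _ => 1 + intervalMatrix N (N * K) := by
        rw [tensor_smul, Fintype.card_fin]
    _ ≤ _ := psd_smul_mono h1 (by positivity)

theorem massiveMatrix_isUnit (d N M : ℕ) {ν : ℝ} (hν : 0 ≤ ν) :
    IsUnit (massiveMatrix d N M ν) := by
  have h : (massiveMatrix d N M ν).PosDef := by
    have := Matrix.PosDef.one.add_posSemidef (Matrix.le_iff.mp (one_le_massiveMatrix d N M hν))
    rwa [add_sub_cancel] at this
  exact h.isUnit

/-- If `e_x e_xᵀ ≤ r S` for all `x`, then the entries of `S⁻¹` are at most `r`: evaluate both forms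
at the columns of `S⁻¹`. -/
theorem abs_inv_apply_le {X : Type*} [Fintype X] [DecidableEq X] {S : Matrix X X ℝ} {r : ℝ}
    (hr : 0 ≤ r) (hS : IsUnit S) (hS0 : 0 ≤ S)
    (h : ∀ x, Matrix.single x x (1 : ℝ) ≤ r • S) (x y : X) : |S⁻¹ x y| ≤ r := by
  have hinv : S * S⁻¹ = 1 := Matrix.mul_nonsing_inv S ((Matrix.isUnit_iff_isUnit_det S).mp hS)
  have key : ∀ x y, S⁻¹ x y ^ 2 ≤ r * S⁻¹ y y := by
    intro x y
    have h1 := dotProduct_mulVec_le (h x) (S⁻¹ *ᵥ Pi.single y 1)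
    rw [Matrix.smul_mulVec, Matrix.mulVec_mulVec (M := S), hinv, Matrix.one_mulVec, dotProduct_smul,
      smul_eq_mul, dotProduct_single, mul_one] at h1
    refine le_of_eq_of_le ?_ (h1.trans_eq ?_)
    · simp [Matrix.single_mulVec, dotProduct, Function.update_apply, sq]
    · simp
  have hdiag : ∀ y, S⁻¹ y y ≤ r := by
    intro y
    have h1 := key y y
    by_contra! h2
    nlinarith
  refine abs_le_of_sq_le_sq ?_ hr
  have hnn : 0 ≤ S⁻¹ y y := (Matrix.nonneg_iff_posSemidef.mp hS0).inv.diag_nonneg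
  exact (key x y).trans (by rw [sq]; exact mul_le_mul_of_nonneg_left (hdiag y) hr)

/-- The kernel of `(1 + ν - Δ) ^ (-d)` is bounded uniformly in the lattice spacing. -/
theorem abs_massiveMatrix_inv_pow_apply_le {d N K : ℕ} (hN : 0 < N) (hK : 0 < K) {ν : ℝ}
    (hν : 0 ≤ ν) (x y : Fin d → Fin (N * K + 1)) :
    |((massiveMatrix d N (N * K) ν)⁻¹ ^ d) x y| ≤ (2 * (N : ℝ)⁻¹) ^ d := by
  rw [Matrix.inv_pow']
  have hS0 : 0 ≤ massiveMatrix d N (N * K) ν :=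
    zero_le_one.trans (one_le_massiveMatrix d N (N * K) hν)
  refine abs_inv_apply_le (by positivity) ((massiveMatrix_isUnit d N (N * K) hν).pow d) ?_
    (single_le_massiveMatrix_pow hN hK hν) x y
  rw [Matrix.nonneg_iff_posSemidef] at hS0 ⊢
  exact hS0.pow d

/-! ### Exponentially weighted `ℓ²` estimates -/

section CombesThomas

variable {X : Type*} [Fintype X] [DecidableEq X]

/-- Conjugation of a symmetric matrix by `exp w` changes its quadratic form by at most the Schur
bound of `|T x y| (cosh (w x - w y) - 1)`. -/
theorem dotProduct_le_conj_add {T : Matrix X X ℝ} (hT : T.IsSymm) (w : X → ℝ) {ε : ℝ}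
    (hrow : ∀ x, ∑ y, |T x y| * (Real.cosh (w x - w y) - 1) ≤ ε) (v : X → ℝ) :
    v ⬝ᵥ (T *ᵥ v) ≤ ∑ x, ∑ y, T x y * Real.exp (w x - w y) * (v x * v y) + ε * (v ⬝ᵥ v) := by
  have hsymm : ∀ x y, T y x = T x y := fun x y => hT.apply x y
  have hcosh : ∑ x, ∑ y, T x y * Real.exp (w x - w y) * (v x * v y) =
      ∑ x, ∑ y, T x y * Real.cosh (w x - w y) * (v x * v y) := by
    have hswap : ∑ x, ∑ y, T x y * Real.exp (w x - w y) * (v x * v y) =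
        ∑ x, ∑ y, T x y * Real.exp (-(w x - w y)) * (v x * v y) := by
      rw [Finset.sum_comm]
      refine Finset.sum_congr rfl fun x _ => Finset.sum_congr rfl fun y _ => ?_
      rw [hsymm x y, neg_sub, mul_comm (v y)]
    have h2 : (2 : ℝ) * ∑ x, ∑ y, T x y * Real.exp (w x - w y) * (v x * v y) =
        2 * ∑ x, ∑ y, T x y * Real.cosh (w x - w y) * (v x * v y) := by
      rw [two_mul]
      nth_rewrite 2 [hswap]
      simp only [Finset.mul_sum, ← Finset.sum_add_distrib]
      refine Finset.sum_congr rfl fun x _ => Finset.sum_congr rfl fun y _ => ?_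
      rw [Real.cosh_eq]
      ring
    linarith
  have hform : v ⬝ᵥ (T *ᵥ v) = ∑ x, ∑ y, T x y * (v x * v y) := by
    simp only [dotProduct, Matrix.mulVec, Finset.mul_sum]
    exact Finset.sum_congr rfl fun x _ => Finset.sum_congr rfl fun y _ => by ring
  have hschur : ∑ x, ∑ y, |T x y| * (Real.cosh (w x - w y) - 1) * ((v x ^ 2 + v y ^ 2) / 2) ≤
      ε * (v ⬝ᵥ v) := by
    have h1 : ∑ x, ∑ y, |T x y| * (Real.cosh (w x - w y) - 1) * v y ^ 2 =
        ∑ x, ∑ y, |T x y| * (Real.cosh (w x - w y) - 1) * v x ^ 2 := by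
      rw [Finset.sum_comm]
      refine Finset.sum_congr rfl fun x _ => Finset.sum_congr rfl fun y _ => ?_
      rw [hsymm x y, ← Real.cosh_neg, neg_sub]
    have h2 : ∑ x, ∑ y, |T x y| * (Real.cosh (w x - w y) - 1) * ((v x ^ 2 + v y ^ 2) / 2) =
        ∑ x, ∑ y, |T x y| * (Real.cosh (w x - w y) - 1) * v x ^ 2 := by
      have : ∑ x, ∑ y, |T x y| * (Real.cosh (w x - w y) - 1) * ((v x ^ 2 + v y ^ 2) / 2) =
          (∑ x, ∑ y, |T x y| * (Real.cosh (w x - w y) - 1) * v x ^ 2 +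
          ∑ x, ∑ y, |T x y| * (Real.cosh (w x - w y) - 1) * v y ^ 2) / 2 := by
        simp only [← Finset.sum_add_distrib, Finset.sum_div]
        exact Finset.sum_congr rfl fun x _ => Finset.sum_congr rfl fun y _ => by ring
      rw [this, h1]
      ring
    rw [h2, dotProduct, Finset.mul_sum]
    refine Finset.sum_le_sum fun x _ => ?_
    rw [← Finset.sum_mul, ← sq]
    exact mul_le_mul_of_nonneg_right (hrow x) (sq_nonneg _)
  rw [hform, hcosh]
  refine le_trans ?_ (add_le_add_right hschur _)
  simp only [← Finset.sum_add_distrib]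
  refine Finset.sum_le_sum fun x _ => Finset.sum_le_sum fun y _ => ?_
  have hc : 0 ≤ Real.cosh (w x - w y) - 1 := sub_nonneg.mpr (Real.one_le_cosh _)
  have h1 : -(T x y * (v x * v y)) ≤ |T x y| * ((v x ^ 2 + v y ^ 2) / 2) := by
    refine (neg_le_abs _).trans ?_
    rw [abs_mul]
    refine mul_le_mul_of_nonneg_left ?_ (abs_nonneg _)
    rw [abs_le]
    constructor <;> nlinarith [sq_nonneg (v x + v y), sq_nonneg (v x - v y)]
  nlinarith [mul_le_mul_of_nonneg_right h1 hc]

/-- The Combes–Thomas estimate for a symmetric matrix with spectral gap `γ`. -/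
theorem sum_weighted_sq_le {T : Matrix X X ℝ} (hT : T.IsSymm) (w : X → ℝ) {γ : ℝ} (hγ : 0 < γ)
    (hgap : γ • 1 ≤ T)
    (hrow : ∀ x, ∑ y, |T x y| * (Real.cosh (w x - w y) - 1) ≤ γ / 2) (u : X → ℝ) :
    ∑ x, (Real.exp (w x) * u x) ^ 2 ≤
      4 / γ ^ 2 * ∑ x, (Real.exp (w x) * (T *ᵥ u) x) ^ 2 := by
  set v : X → ℝ := fun x => Real.exp (w x) * u x with hv
  set G : X → ℝ := fun x => Real.exp (w x) * (T *ᵥ u) x with hG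
  have h1 := dotProduct_le_conj_add hT w hrow v
  have h2 := dotProduct_mulVec_le hgap v
  rw [Matrix.smul_mulVec, Matrix.one_mulVec, dotProduct_smul, smul_eq_mul] at h2
  -- The conjugated form at `v = exp w * u` pairs `v` with `exp w * T u`.
  have h3 : ∑ x, ∑ y, T x y * Real.exp (w x - w y) * (v x * v y) = ∑ x, v x * G x := by
    refine Finset.sum_congr rfl fun x _ => ?_
    simp only [hG, Matrix.mulVec, dotProduct, Finset.mul_sum]
    refine Finset.sum_congr rfl fun y _ => ?_
    simp only [hv, Real.exp_sub]
    have := Real.exp_ne_zero (w y)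
    field_simp
  have h4 : ∑ x, v x * G x ≤ γ / 4 * ∑ x, v x ^ 2 + 1 / γ * ∑ x, G x ^ 2 := by
    simp only [Finset.mul_sum, ← Finset.sum_add_distrib]
    refine Finset.sum_le_sum fun x _ => ?_
    have : γ / 4 * v x ^ 2 + 1 / γ * G x ^ 2 - v x * G x = 1 / γ * (γ / 2 * v x - G x) ^ 2 := by
      field_simp
      ring
    have h5 : 0 ≤ 1 / γ * (γ / 2 * v x - G x) ^ 2 := by positivity
    linarith
  have h5 : v ⬝ᵥ v = ∑ x, v x ^ 2 := by simp [dotProduct, sq]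
  rw [h5] at h1 h2
  have h6 : γ / 4 * ∑ x, v x ^ 2 ≤ 1 / γ * ∑ x, G x ^ 2 := by linarith
  calc ∑ x, v x ^ 2 = 4 / γ * (γ / 4 * ∑ x, v x ^ 2) := by field_simp
    _ ≤ 4 / γ * (1 / γ * ∑ x, G x ^ 2) := mul_le_mul_of_nonneg_left h6 (by positivity)
    _ = 4 / γ ^ 2 * ∑ x, G x ^ 2 := by field_simp

end CombesThomas

/-- The `ℓ¹` distance on `ℝ ^ d`. -/
def taxi {d : ℕ} (p q : Fin d → ℝ) : ℝ := ∑ i, |p i - q i|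

theorem taxi_nonneg {d : ℕ} (p q : Fin d → ℝ) : 0 ≤ taxi p q :=
  Finset.sum_nonneg fun _ _ => abs_nonneg _

theorem taxi_comm {d : ℕ} (p q : Fin d → ℝ) : taxi p q = taxi q p :=
  Finset.sum_congr rfl fun _ _ => abs_sub_comm _ _

theorem taxi_triangle {d : ℕ} (p q r : Fin d → ℝ) : taxi p r ≤ taxi p q + taxi q r := by
  rw [taxi, taxi, taxi, ← Finset.sum_add_distrib]
  exact Finset.sum_le_sum fun i _ => abs_sub_le _ _ _

/-- The position in `ℝ ^ d` of a site of the lattice of spacing `1 / N`. -/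
def sitePos {d M : ℕ} (N : ℕ) (x : Fin d → Fin (M + 1)) (i : Fin d) : ℝ :=
  (N : ℝ)⁻¹ * ((x i : ℕ) : ℝ)

theorem cosh_sub_one_le_sq {t : ℝ} (ht : |t| ≤ 1) : Real.cosh t - 1 ≤ t ^ 2 := by
  have h1 := Real.cosh_le_exp_half_sq t
  have ht2 : t ^ 2 ≤ 1 := by
    rw [← sq_abs]
    nlinarith [abs_nonneg t]
  have h2 : |t ^ 2 / 2| ≤ 1 := by
    rw [abs_of_nonneg (by positivity)]
    linarith
  have h3 := (le_abs_self _).trans (Real.abs_exp_sub_one_le h2)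
  rw [abs_of_nonneg (by positivity)] at h3
  linarith

theorem cosh_sub_one_mono {s t : ℝ} (h : |s| ≤ |t|) : Real.cosh s - 1 ≤ Real.cosh t - 1 :=
  sub_le_sub_right (Real.cosh_le_cosh.mpr h) 1

theorem sum_abs_intervalMatrix_mul_le (N M : ℕ) (i : Fin (M + 1)) {φ : Fin (M + 1) → ℝ}
    (hφ : ∀ t, 0 ≤ φ t) (hi : φ i = 0) :
    ∑ t, |intervalMatrix N M i t| * φ t ≤ (N : ℝ) ^ 2 * (φ (nextSite i) + φ (prevSite i)) := by
  have h : ∀ t, |intervalMatrix N M i t| * φ t ≤ (N : ℝ) ^ 2 *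
      ((if t = nextSite i then φ t else 0) + (if t = prevSite i then φ t else 0)) := by
    intro t
    by_cases ht : t = i
    · subst ht
      simp [hi]
    · simp only [intervalMatrix, Matrix.of_apply, if_neg ht]
      rw [abs_mul, abs_of_nonneg (by positivity : (0 : ℝ) ≤ (N : ℝ) ^ 2), mul_assoc]
      refine mul_le_mul_of_nonneg_left ?_ (by positivity)
      have := hφ t
      split_ifs <;> norm_num
      linarith
  refine (Finset.sum_le_sum fun t _ => h t).trans_eq ?_
  rw [← Finset.mul_sum, Finset.sum_add_distrib, Finset.sum_ite_eq', Finset.sum_ite_eq']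
  simp

theorem abs_nextSite_sub_le {N M : ℕ} (i : Fin (M + 1)) :
    |(N : ℝ)⁻¹ * ((i : ℕ) : ℝ) - (N : ℝ)⁻¹ * ((nextSite i : ℕ) : ℝ)| ≤ (N : ℝ)⁻¹ := by
  rw [← mul_sub, abs_mul, abs_of_nonneg (by positivity : (0 : ℝ) ≤ (N : ℝ)⁻¹)]
  refine mul_le_of_le_one_right (by positivity) ?_
  have h1 : (i : ℕ) ≤ (nextSite i : ℕ) := by simp [nextSite]; omega
  have h2 : (nextSite i : ℕ) ≤ (i : ℕ) + 1 := by simp [nextSite]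
  rw [abs_le]
  have h1' : ((i : ℕ) : ℝ) ≤ ((nextSite i : ℕ) : ℝ) := by exact_mod_cast h1
  have h2' : ((nextSite i : ℕ) : ℝ) ≤ ((i : ℕ) : ℝ) + 1 := by exact_mod_cast h2
  constructor <;> linarith

theorem abs_prevSite_sub_le {N M : ℕ} (i : Fin (M + 1)) :
    |(N : ℝ)⁻¹ * ((i : ℕ) : ℝ) - (N : ℝ)⁻¹ * ((prevSite i : ℕ) : ℝ)| ≤ (N : ℝ)⁻¹ := by
  rw [← mul_sub, abs_mul, abs_of_nonneg (by positivity : (0 : ℝ) ≤ (N : ℝ)⁻¹)]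
  refine mul_le_of_le_one_right (by positivity) ?_
  have h1 : (prevSite i : ℕ) ≤ (i : ℕ) := by simp [prevSite]
  have h2 : (i : ℕ) ≤ (prevSite i : ℕ) + 1 := by simp [prevSite]; omega
  rw [abs_le]
  have h1' : ((prevSite i : ℕ) : ℝ) ≤ ((i : ℕ) : ℝ) := by exact_mod_cast h1
  have h2' : ((i : ℕ) : ℝ) ≤ ((prevSite i : ℕ) : ℝ) + 1 := by exact_mod_cast h2
  constructor <;> linarith

theorem taxi_update_sub {d N M : ℕ} (x : Fin d → Fin (M + 1)) (y : Fin d → ℝ) (μ : Fin d)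
    (t : Fin (M + 1)) :
    |taxi (sitePos N x) y - taxi (sitePos N (Function.update x μ t)) y| ≤
      |(N : ℝ)⁻¹ * ((x μ : ℕ) : ℝ) - (N : ℝ)⁻¹ * ((t : ℕ) : ℝ)| := by
  rw [taxi, taxi, ← Finset.sum_sub_distrib]
  have h : ∀ i ∈ Finset.univ, i ≠ μ → |sitePos N x i - y i| -
      |sitePos N (Function.update x μ t) i - y i| = 0 := by
    intro i _ hi
    rw [sitePos, sitePos, Function.update_of_ne hi, sub_self]
  rw [Finset.sum_eq_single_of_mem μ (Finset.mem_univ μ) h, sitePos, sitePos, Function.update_self]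
  refine (abs_abs_sub_abs_le_abs_sub _ _).trans_eq ?_
  congr 1
  ring

/-- The Schur bound for the Laplacian: the lattice spacing drops out, since the weight changes by
`α / N` between neighbours. -/
theorem sum_abs_cubeMatrix_mul_cosh_le {d N M : ℕ} (hN : 0 < N) {α : ℝ} (hα : 0 ≤ α) (hα1 : α ≤ 1)
    (y : Fin d → ℝ) (x : Fin d → Fin (M + 1)) :
    ∑ x', |cubeMatrix d N M x x'| *
      (Real.cosh (α * taxi (sitePos N x) y - α * taxi (sitePos N x') y) - 1) ≤ 2 * d * α ^ 2 := by
  set φ : (Fin d → Fin (M + 1)) → ℝ := fun x' =>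
    Real.cosh (α * taxi (sitePos N x) y - α * taxi (sitePos N x') y) - 1 with hφ
  have hφ0 : ∀ x', 0 ≤ φ x' := fun x' => sub_nonneg.mpr (Real.one_le_cosh _)
  have hN1 : (1 : ℝ) ≤ N := by exact_mod_cast hN
  have hNinv : (N : ℝ)⁻¹ ≤ 1 := inv_le_one_of_one_le₀ hN1
  have hsmall : ∀ (μ : Fin d) (t : Fin (M + 1)),
      |(N : ℝ)⁻¹ * ((x μ : ℕ) : ℝ) - (N : ℝ)⁻¹ * ((t : ℕ) : ℝ)| ≤ (N : ℝ)⁻¹ →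
      φ (Function.update x μ t) ≤ (α * (N : ℝ)⁻¹) ^ 2 := by
    intro μ t ht
    have hs : |α * (N : ℝ)⁻¹| = α * (N : ℝ)⁻¹ := abs_of_nonneg (by positivity)
    refine (cosh_sub_one_mono (t := α * (N : ℝ)⁻¹) ?_).trans (cosh_sub_one_le_sq ?_)
    · rw [← mul_sub, abs_mul, abs_of_nonneg hα, hs]
      exact mul_le_mul_of_nonneg_left ((taxi_update_sub x y μ t).trans ht) hα
    · rw [hs]
      exact mul_le_one₀ hα1 (by positivity) hNinv
  have hμ : ∀ μ, ∑ x', |lift μ (intervalMatrix N M) x x'| * φ x' ≤ 2 * α ^ 2 := by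
    intro μ
    simp only [abs_lift_apply]
    refine (lift_mulVec μ _ φ x).trans_le ?_
    simp only [Matrix.map_apply]
    refine (sum_abs_intervalMatrix_mul_le N M (x μ) (φ := fun t => φ (Function.update x μ t))
      (fun t => hφ0 _) (by simp [hφ])).trans ?_
    have h1 := hsmall μ _ (abs_nextSite_sub_le (x μ))
    have h2 := hsmall μ _ (abs_prevSite_sub_le (x μ))
    calc (N : ℝ) ^ 2 * (φ (Function.update x μ (nextSite (x μ))) +
          φ (Function.update x μ (prevSite (x μ))))
        ≤ (N : ℝ) ^ 2 * ((α * (N : ℝ)⁻¹) ^ 2 + (α * (N : ℝ)⁻¹) ^ 2) :=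
          mul_le_mul_of_nonneg_left (add_le_add h1 h2) (by positivity)
      _ = 2 * α ^ 2 := by
          field_simp
          ring
  calc ∑ x', |cubeMatrix d N M x x'| * φ x'
      ≤ ∑ x', ∑ μ, |lift μ (intervalMatrix N M) x x'| * φ x' := by
        refine Finset.sum_le_sum fun x' _ => ?_
        rw [← Finset.sum_mul, cubeMatrix, Matrix.sum_apply]
        exact mul_le_mul_of_nonneg_right (Finset.abs_sum_le_sum_abs _ _) (hφ0 x')
    _ = ∑ μ, ∑ x', |lift μ (intervalMatrix N M) x x'| * φ x' := Finset.sum_comm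
    _ ≤ ∑ μ : Fin d, 2 * α ^ 2 := Finset.sum_le_sum fun μ _ => hμ μ
    _ = 2 * d * α ^ 2 := by simp; ring

theorem cubeBlockMatrix_apply {d N M : ℕ} (x x' : Fin d → Fin (M + 1)) :
    cubeBlockMatrix d N M x x' =
      if ∀ μ, (x' μ : ℕ) / N = (x μ : ℕ) / N then ((N : ℝ)⁻¹) ^ d else 0 := by
  simp only [cubeBlockMatrix, tensor_apply, blockMatrix, Matrix.of_apply]
  rw [Fintype.prod_ite_zero]
  simp

theorem cubeBlockMatrix_apply_nonneg {d N M : ℕ} (x x' : Fin d → Fin (M + 1)) :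
    0 ≤ cubeBlockMatrix d N M x x' := by
  rw [cubeBlockMatrix_apply]
  positivity

theorem sum_cubeBlockMatrix_le_one {d N M : ℕ} (hN : 0 < N) (x : Fin d → Fin (M + 1)) :
    ∑ x', cubeBlockMatrix d N M x x' ≤ 1 := by
  simp only [cubeBlockMatrix, tensor_apply]
  rw [← Fintype.prod_sum fun μ t => blockMatrix N M (x μ) t]
  have h0 : ∀ i t, 0 ≤ blockMatrix N M i t := fun i t => by
    simp only [blockMatrix, Matrix.of_apply]
    positivity
  refine Finset.prod_le_one (fun μ _ => Finset.sum_nonneg fun t _ => h0 _ _) fun μ _ => ?_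
  simp only [blockMatrix, Matrix.of_apply]
  rw [← Finset.sum_filter, Finset.sum_const, nsmul_eq_mul]
  have hN' : (0 : ℝ) < N := by exact_mod_cast hN
  rw [← div_eq_mul_inv, div_le_one hN']
  exact_mod_cast card_block_le hN _

/-- Sites of the same unit block are at `ℓ¹` distance at most `d`. -/
theorem taxi_le_of_block {d N M : ℕ} (hN : 0 < N) {x x' : Fin d → Fin (M + 1)}
    (h : ∀ μ, (x' μ : ℕ) / N = (x μ : ℕ) / N) : taxi (sitePos N x) (sitePos N x') ≤ d := by
  have hN' : (0 : ℝ) < N := by exact_mod_cast hN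
  have : ∀ i, |sitePos N x i - sitePos N x' i| ≤ 1 := by
    intro i
    have h1 := Nat.div_add_mod (x i : ℕ) N
    have h2 := Nat.div_add_mod (x' i : ℕ) N
    rw [h i] at h2
    have h3 := Nat.mod_lt (x i : ℕ) hN
    have h4 := Nat.mod_lt (x' i : ℕ) hN
    have h5 : (x i : ℕ) ≤ (x' i : ℕ) + N := by omega
    have h6 : (x' i : ℕ) ≤ (x i : ℕ) + N := by omega
    have h5' : ((x i : ℕ) : ℝ) ≤ ((x' i : ℕ) : ℝ) + N := by exact_mod_cast h5
    have h6' : ((x' i : ℕ) : ℝ) ≤ ((x i : ℕ) : ℝ) + N := by exact_mod_cast h6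
    rw [sitePos, sitePos, ← mul_sub, abs_mul, abs_of_nonneg (by positivity : (0 : ℝ) ≤ (N : ℝ)⁻¹),
      inv_mul_le_iff₀ hN', abs_le]
    constructor <;> linarith
  calc taxi (sitePos N x) (sitePos N x') ≤ ∑ _i : Fin d, (1 : ℝ) :=
        Finset.sum_le_sum fun i _ => this i
    _ = d := by simp

theorem abs_taxi_sub_le {d : ℕ} (p q r : Fin d → ℝ) : |taxi p r - taxi q r| ≤ taxi p q := by
  rw [abs_le]
  have h1 := taxi_triangle p q r
  have h2 := taxi_triangle q p r
  rw [taxi_comm q p] at h2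
  constructor <;> linarith

theorem sum_cubeBlockMatrix_mul_cosh_le {d N M : ℕ} (hN : 0 < N) {α : ℝ} (hα : 0 ≤ α)
    (hαd : α * d ≤ 1) (y : Fin d → ℝ) (x : Fin d → Fin (M + 1)) :
    ∑ x', |cubeBlockMatrix d N M x x'| *
      (Real.cosh (α * taxi (sitePos N x) y - α * taxi (sitePos N x') y) - 1) ≤ (α * d) ^ 2 := by
  have hαd0 : |α * d| = α * d := abs_of_nonneg (by positivity)
  have h : ∀ x', |cubeBlockMatrix d N M x x'| *
      (Real.cosh (α * taxi (sitePos N x) y - α * taxi (sitePos N x') y) - 1) ≤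
      cubeBlockMatrix d N M x x' * (α * d) ^ 2 := by
    intro x'
    rw [abs_of_nonneg (cubeBlockMatrix_apply_nonneg x x'), cubeBlockMatrix_apply]
    split_ifs with hb
    · refine mul_le_mul_of_nonneg_left ?_ (by positivity)
      refine (cosh_sub_one_mono (t := α * d) ?_).trans (cosh_sub_one_le_sq (by rwa [hαd0]))
      rw [← mul_sub, abs_mul, abs_of_nonneg hα, hαd0]
      exact mul_le_mul_of_nonneg_left
        ((abs_taxi_sub_le _ _ _).trans (taxi_le_of_block hN hb)) hα
    · simp
  refine (Finset.sum_le_sum fun x' _ => h x').trans ?_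
  rw [← Finset.sum_mul]
  exact mul_le_of_le_one_left (sq_nonneg _) (sum_cubeBlockMatrix_le_one hN x)

/-- The matrix of `-Δ + ν + b Q^* Q`. -/
def greenMatrix (d N M : ℕ) (ν b : ℝ) : Matrix (Fin d → Fin (M + 1)) (Fin d → Fin (M + 1)) ℝ :=
  cubeMatrix d N M + ν • 1 + b • cubeBlockMatrix d N M

theorem greenMatrix_gap {d N K : ℕ} (hN : 0 < N) (hK : 0 < K) {ν b γ : ℝ} (hν : 0 ≤ ν)
    (hγ : 0 ≤ γ) (hγ1 : γ * 4 ^ d ≤ 1) (hγb : γ * 4 ^ d ≤ b) :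
    γ • 1 ≤ greenMatrix d N (N * K) ν b := by
  have h1 := psd_smul_mono (one_le_cubeMatrix_add_cubeBlockMatrix d hN hK) hγ
  have h2 := psd_smul_nonneg (cubeMatrix_nonneg d N (N * K)) (sub_nonneg.mpr hγ1)
  have h3 := psd_smul_nonneg (cubeBlockMatrix_nonneg d N K) (sub_nonneg.mpr hγb)
  have h4 := psd_smul_nonneg (one_psd_nonneg (X := Fin d → Fin (N * K + 1))) hν
  refine h1.trans ?_
  have h5 : greenMatrix d N (N * K) ν b =
      γ • (4 : ℝ) ^ d • (cubeMatrix d N (N * K) + cubeBlockMatrix d N (N * K)) +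
      ((1 - γ * 4 ^ d) • cubeMatrix d N (N * K) + (b - γ * 4 ^ d) • cubeBlockMatrix d N (N * K) +
        ν • 1) := by
    rw [greenMatrix]
    module
  rw [h5]
  exact le_add_of_nonneg_right (add_nonneg (add_nonneg h2 h3) h4)

theorem sum_greenMatrix_mul_cosh_le {d N M : ℕ} (hN : 0 < N) {α b : ℝ} (ν : ℝ) (hα : 0 ≤ α)
    (hα1 : α ≤ 1) (hαd : α * d ≤ 1) (hb : 0 ≤ b) (y : Fin d → ℝ) (x : Fin d → Fin (M + 1)) :
    ∑ x', |greenMatrix d N M ν b x x'| *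
      (Real.cosh (α * taxi (sitePos N x) y - α * taxi (sitePos N x') y) - 1) ≤
      2 * d * α ^ 2 + b * (α * d) ^ 2 := by
  have h1 := sum_abs_cubeMatrix_mul_cosh_le (M := M) hN hα hα1 y x
  have h2 := mul_le_mul_of_nonneg_left
    (sum_cubeBlockMatrix_mul_cosh_le (M := M) hN hα hαd y x) hb
  refine le_trans ?_ (add_le_add h1 h2)
  rw [Finset.mul_sum, ← Finset.sum_add_distrib]
  refine Finset.sum_le_sum fun x' _ => ?_
  have hφ0 : 0 ≤ Real.cosh (α * taxi (sitePos N x) y - α * taxi (sitePos N x') y) - 1 :=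
    sub_nonneg.mpr (Real.one_le_cosh _)
  rw [← mul_assoc, ← add_mul]
  -- The mass term is diagonal, where the weight factor vanishes.
  by_cases hx : x = x'
  · subst hx
    simp
  · refine mul_le_mul_of_nonneg_right ?_ hφ0
    simp only [greenMatrix, Matrix.add_apply, Matrix.smul_apply, Matrix.one_apply_ne hx,
      smul_eq_mul, mul_zero, add_zero]
    refine (abs_add_le _ _).trans_eq ?_
    rw [abs_mul, abs_of_nonneg hb]

/-! ### The maximum principle and weighted row sums of the massive resolvent -/

theorem cubeMatrix_mulVec (d N M : ℕ) (f : (Fin d → Fin (M + 1)) → ℝ) (x : Fin d → Fin (M + 1)) :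
    (cubeMatrix d N M *ᵥ f) x = ∑ μ, (N : ℝ) ^ 2 * (2 * f x
      - f (Function.update x μ (nextSite (x μ))) - f (Function.update x μ (prevSite (x μ)))) := by
  rw [cubeMatrix, Matrix.sum_mulVec, Finset.sum_apply]
  refine Finset.sum_congr rfl fun μ _ => ?_
  rw [lift_mulVec]
  have := intervalMatrix_mulVec N M (fun t => f (Function.update x μ t)) (x μ)
  rw [Function.update_eq_self] at this
  exact this

theorem massiveMatrix_mulVec (d N M : ℕ) (ν : ℝ) (f : (Fin d → Fin (M + 1)) → ℝ)
    (x : Fin d → Fin (M + 1)) :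
    (massiveMatrix d N M ν *ᵥ f) x = (1 + ν) * f x + (cubeMatrix d N M *ᵥ f) x := by
  simp [massiveMatrix, Matrix.add_mulVec, Matrix.smul_mulVec]

/-- The minimum principle for `1 + ν - Δ`. -/
theorem nonneg_of_massiveMatrix_mulVec_nonneg {d N M : ℕ} {ν : ℝ} (hν : 0 ≤ ν)
    {f : (Fin d → Fin (M + 1)) → ℝ} (h : ∀ x, 0 ≤ (massiveMatrix d N M ν *ᵥ f) x)
    (x : Fin d → Fin (M + 1)) : 0 ≤ f x := by
  -- At a minimum `z` of `f` one has `(-Δ f) z ≤ 0`.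
  obtain ⟨z, -, hz⟩ := Finset.exists_min_image Finset.univ f ⟨x, Finset.mem_univ x⟩
  have h1 := h z
  rw [massiveMatrix_mulVec, cubeMatrix_mulVec] at h1
  have h2 : ∑ μ, (N : ℝ) ^ 2 * (2 * f z - f (Function.update z μ (nextSite (z μ)))
      - f (Function.update z μ (prevSite (z μ)))) ≤ 0 := by
    refine Finset.sum_nonpos fun μ _ => mul_nonpos_of_nonneg_of_nonpos (by positivity) ?_
    have h3 := hz (Function.update z μ (nextSite (z μ))) (Finset.mem_univ _)
    have h4 := hz (Function.update z μ (prevSite (z μ))) (Finset.mem_univ _)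
    linarith
  have h5 : 0 ≤ (1 + ν) * f z := by linarith
  exact (nonneg_of_mul_nonneg_right h5 (by linarith)).trans (hz x (Finset.mem_univ x))

theorem massiveMatrix_mul_inv (d N M : ℕ) {ν : ℝ} (hν : 0 ≤ ν) :
    massiveMatrix d N M ν * (massiveMatrix d N M ν)⁻¹ = 1 :=
  Matrix.mul_nonsing_inv _ ((Matrix.isUnit_iff_isUnit_det _).mp (massiveMatrix_isUnit d N M hν))

theorem massiveMatrix_inv_mul (d N M : ℕ) {ν : ℝ} (hν : 0 ≤ ν) :
    (massiveMatrix d N M ν)⁻¹ * massiveMatrix d N M ν = 1 :=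
  Matrix.nonsing_inv_mul _ ((Matrix.isUnit_iff_isUnit_det _).mp (massiveMatrix_isUnit d N M hν))

theorem massiveMatrix_inv_apply_nonneg {d N M : ℕ} {ν : ℝ} (hν : 0 ≤ ν)
    (x y : Fin d → Fin (M + 1)) : 0 ≤ (massiveMatrix d N M ν)⁻¹ x y := by
  have h := nonneg_of_massiveMatrix_mulVec_nonneg (N := N) hν
    (f := (massiveMatrix d N M ν)⁻¹ *ᵥ Pi.single y 1) (fun z => by
      rw [Matrix.mulVec_mulVec, massiveMatrix_mul_inv d N M hν, Matrix.one_mulVec]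
      have h1 : 0 ≤ (Pi.single y 1 : (Fin d → Fin (M + 1)) → ℝ) :=
        Pi.single_nonneg.mpr zero_le_one
      exact h1 z) x
  simpa using h

theorem massiveMatrix_inv_pow_apply_nonneg {d N M : ℕ} {ν : ℝ} (hν : 0 ≤ ν) (n : ℕ)
    (x y : Fin d → Fin (M + 1)) : 0 ≤ ((massiveMatrix d N M ν)⁻¹ ^ n) x y := by
  induction n generalizing x with
  | zero => rw [pow_zero, Matrix.one_apply]; positivity
  | succ n ih =>
    rw [pow_succ', Matrix.mul_apply]
    exact Finset.sum_nonneg fun z _ => mul_nonneg (massiveMatrix_inv_apply_nonneg hν x z) (ih z)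

/-- The weight `∏ μ, cosh (β (x_μ - c_μ))`, a smooth substitute for `exp (β |x - c|₁)`. -/
def coshWeight {d M : ℕ} (N : ℕ) (β : ℝ) (c x : Fin d → Fin (M + 1)) : ℝ :=
  ∏ μ, Real.cosh (β * (sitePos N x μ - sitePos N c μ))

theorem coshWeight_pos {d M : ℕ} (N : ℕ) (β : ℝ) (c x : Fin d → Fin (M + 1)) :
    0 < coshWeight N β c x := Finset.prod_pos fun _ _ => Real.cosh_pos _

theorem exp_taxi_le_coshWeight {d M : ℕ} (N : ℕ) {β : ℝ} (hβ : 0 ≤ β) (c x : Fin d → Fin (M + 1)) :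
    Real.exp (β * taxi (sitePos N c) (sitePos N x)) ≤ 2 ^ d * coshWeight N β c x := by
  have h : (2 : ℝ) ^ d = ∏ _μ : Fin d, (2 : ℝ) := by simp
  rw [taxi, Finset.mul_sum, Real.exp_sum, coshWeight, h, ← Finset.prod_mul_distrib]
  refine Finset.prod_le_prod (fun _ _ => (Real.exp_pos _).le) fun μ _ => ?_
  rw [← Real.cosh_abs, abs_mul, abs_of_nonneg hβ, abs_sub_comm (sitePos N x μ), Real.cosh_eq]
  have := Real.exp_pos (-(β * |sitePos N c μ - sitePos N x μ|))
  linarith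

theorem coshWeight_update {d M : ℕ} (N : ℕ) (β : ℝ) (c x : Fin d → Fin (M + 1)) (μ : Fin d)
    (t : Fin (M + 1)) :
    coshWeight N β c (Function.update x μ t) =
      Real.cosh (β * ((N : ℝ)⁻¹ * ((t : ℕ) : ℝ) - sitePos N c μ)) *
      ∏ ν ∈ Finset.univ.erase μ, Real.cosh (β * (sitePos N x ν - sitePos N c ν)) := by
  rw [coshWeight, ← Finset.mul_prod_erase _ _ (Finset.mem_univ μ)]
  congr 1
  · rw [sitePos, Function.update_self]
  · refine Finset.prod_congr rfl fun ν hν => ?_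
    rw [sitePos, Function.update_of_ne (Finset.ne_of_mem_erase hν), sitePos, sitePos]

/-- In one dimension the Neumann Laplacian of `cosh` is at most the free one, since
`cosh (β (t - c))` grows away from `c`, in particular towards the end points. -/
theorem cosh_neighbours_le {N M : ℕ} (hN : 0 < N) {β : ℝ} (hβ : 0 ≤ β) (hβ1 : β ≤ 1)
    (c i : Fin (M + 1)) :
    (N : ℝ) ^ 2 * (Real.cosh (β * ((N : ℝ)⁻¹ * ((nextSite i : ℕ) : ℝ) - (N : ℝ)⁻¹ * ((c : ℕ) : ℝ)))
      + Real.cosh (β * ((N : ℝ)⁻¹ * ((prevSite i : ℕ) : ℝ) - (N : ℝ)⁻¹ * ((c : ℕ) : ℝ)))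
      - 2 * Real.cosh (β * ((N : ℝ)⁻¹ * ((i : ℕ) : ℝ) - (N : ℝ)⁻¹ * ((c : ℕ) : ℝ)))) ≤
      2 * β ^ 2 * Real.cosh (β * ((N : ℝ)⁻¹ * ((i : ℕ) : ℝ) - (N : ℝ)⁻¹ * ((c : ℕ) : ℝ))) := by
  have hN1 : (1 : ℝ) ≤ N := by exact_mod_cast hN
  have hNinv : (N : ℝ)⁻¹ ≤ 1 := inv_le_one_of_one_le₀ hN1
  have hNinv0 : 0 ≤ (N : ℝ)⁻¹ := by positivity
  set p := β * ((N : ℝ)⁻¹ * ((i : ℕ) : ℝ) - (N : ℝ)⁻¹ * ((c : ℕ) : ℝ)) with hp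
  set h := β * (N : ℝ)⁻¹ with hh
  have hh0 : 0 ≤ h := by positivity
  have hi := i.isLt
  have hc := c.isLt
  have hnext : Real.cosh (β * ((N : ℝ)⁻¹ * ((nextSite i : ℕ) : ℝ) - (N : ℝ)⁻¹ * ((c : ℕ) : ℝ))) ≤
      Real.cosh (p + h) := by
    by_cases hM : (i : ℕ) = M
    · have h1 : (nextSite i : ℕ) = i := by simp [nextSite, hM]
      rw [h1, ← hp]
      have hci : ((c : ℕ) : ℝ) ≤ ((i : ℕ) : ℝ) := by exact_mod_cast (by omega : (c : ℕ) ≤ i)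
      have hp0 : 0 ≤ p := by
        rw [hp, ← mul_sub]
        exact mul_nonneg hβ (mul_nonneg hNinv0 (sub_nonneg.mpr hci))
      rw [Real.cosh_le_cosh, abs_of_nonneg hp0, abs_of_nonneg (by linarith)]
      linarith
    · have h1 : (nextSite i : ℕ) = i + 1 := by simp [nextSite]; omega
      rw [h1]
      refine le_of_eq (congrArg Real.cosh ?_)
      push_cast
      rw [hp, hh]
      ring
  have hprev : Real.cosh (β * ((N : ℝ)⁻¹ * ((prevSite i : ℕ) : ℝ) - (N : ℝ)⁻¹ * ((c : ℕ) : ℝ))) ≤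
      Real.cosh (p - h) := by
    by_cases h0 : (i : ℕ) = 0
    · have h1 : (prevSite i : ℕ) = i := by simp [prevSite, h0]
      rw [h1, ← hp]
      have hci : ((i : ℕ) : ℝ) ≤ ((c : ℕ) : ℝ) := by exact_mod_cast (by omega : (i : ℕ) ≤ c)
      have hp0 : p ≤ 0 := by
        rw [hp, ← mul_sub]
        exact mul_nonpos_of_nonneg_of_nonpos hβ
          (mul_nonpos_of_nonneg_of_nonpos hNinv0 (sub_nonpos.mpr hci))
      rw [Real.cosh_le_cosh, abs_of_nonpos hp0, abs_of_nonpos (by linarith)]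
      linarith
    · have h1 : (i : ℕ) = prevSite i + 1 := by simp [prevSite]; omega
      have h2 : ((i : ℕ) : ℝ) = ((prevSite i : ℕ) : ℝ) + 1 := by exact_mod_cast h1
      refine le_of_eq (congrArg Real.cosh ?_)
      rw [hp, hh, h2]
      ring
  have hsq : (N : ℝ) ^ 2 * (Real.cosh h - 1) ≤ β ^ 2 := by
    have h1 : Real.cosh h - 1 ≤ h ^ 2 :=
      cosh_sub_one_le_sq (by rw [abs_of_nonneg hh0]; exact mul_le_one₀ hβ1 hNinv0 hNinv)
    refine (mul_le_mul_of_nonneg_left h1 (by positivity)).trans_eq ?_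
    rw [hh]
    field_simp
  have hadd : Real.cosh (p + h) + Real.cosh (p - h) = 2 * Real.cosh p * Real.cosh h := by
    rw [Real.cosh_add, Real.cosh_sub]
    ring
  have hcp := Real.cosh_pos p
  calc _ ≤ (N : ℝ) ^ 2 * (2 * Real.cosh p * Real.cosh h - 2 * Real.cosh p) :=
        mul_le_mul_of_nonneg_left (by linarith) (by positivity)
    _ = 2 * ((N : ℝ) ^ 2 * (Real.cosh h - 1)) * Real.cosh p := by ring
    _ ≤ 2 * β ^ 2 * Real.cosh p := by
        refine mul_le_mul_of_nonneg_right ?_ hcp.le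
        linarith

/-- The weight is a supersolution: `(1 + ν - Δ) W ≥ W / 2`. -/
theorem half_coshWeight_le {d N M : ℕ} (hN : 0 < N) {β ν : ℝ} (hν : 0 ≤ ν) (hβ : 0 ≤ β)
    (hβ1 : β ≤ 1) (hβd : 4 * d * β ^ 2 ≤ 1) (c x : Fin d → Fin (M + 1)) :
    coshWeight N β c x ≤ 2 * (massiveMatrix d N M ν *ᵥ coshWeight N β c) x := by
  have hW := coshWeight_pos N β c x
  have hA : -(2 * d * β ^ 2 * coshWeight N β c x) ≤
      (cubeMatrix d N M *ᵥ coshWeight N β c) x := by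
    rw [cubeMatrix_mulVec]
    have h1 : -(2 * d * β ^ 2 * coshWeight N β c x) =
        ∑ _μ : Fin d, -(2 * β ^ 2 * coshWeight N β c x) := by
      simp
      ring
    rw [h1]
    refine Finset.sum_le_sum fun μ _ => ?_
    have hself : coshWeight N β c x = coshWeight N β c (Function.update x μ (x μ)) := by
      rw [Function.update_eq_self]
    rw [hself, coshWeight_update, coshWeight_update, coshWeight_update]
    set P := ∏ ν ∈ Finset.univ.erase μ, Real.cosh (β * (sitePos N x ν - sitePos N c ν))
    have hP : 0 ≤ P := Finset.prod_nonneg fun _ _ => (Real.cosh_pos _).le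
    have h2 := mul_le_mul_of_nonneg_right (cosh_neighbours_le hN hβ hβ1 (c μ) (x μ)) hP
    simp only [sitePos]
    linarith
  rw [massiveMatrix_mulVec]
  nlinarith [mul_nonneg hν hW.le]

theorem massiveMatrix_inv_pow_mulVec_coshWeight_le {d N M : ℕ} (hN : 0 < N) {β ν : ℝ}
    (hν : 0 ≤ ν) (hβ : 0 ≤ β) (hβ1 : β ≤ 1) (hβd : 4 * d * β ^ 2 ≤ 1) (c : Fin d → Fin (M + 1))
    (n : ℕ) (x : Fin d → Fin (M + 1)) :
    ((massiveMatrix d N M ν)⁻¹ ^ n *ᵥ coshWeight N β c) x ≤ 2 ^ n * coshWeight N β c x := by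
  set S := massiveMatrix d N M ν with hS
  set W := coshWeight N β c with hW
  have hone : ∀ z, (S⁻¹ *ᵥ W) z ≤ 2 * W z := by
    intro z
    have h := nonneg_of_massiveMatrix_mulVec_nonneg (N := N) hν
      (f := (2 : ℝ) • W - S⁻¹ *ᵥ W) (fun z => by
        rw [← hS, Matrix.mulVec_sub, Matrix.mulVec_mulVec, massiveMatrix_mul_inv d N M hν,
          Matrix.one_mulVec, Matrix.mulVec_smul, Pi.sub_apply, Pi.smul_apply, smul_eq_mul]
        exact sub_nonneg.mpr (half_coshWeight_le hN hν hβ hβ1 hβd c z)) z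
    simpa using h
  induction n generalizing x with
  | zero => simp
  | succ n ih =>
    rw [pow_succ', ← Matrix.mulVec_mulVec]
    calc (S⁻¹ *ᵥ (S⁻¹ ^ n *ᵥ W)) x ≤ ∑ z, S⁻¹ x z * (2 ^ n * W z) :=
          Finset.sum_le_sum fun z _ =>
            mul_le_mul_of_nonneg_left (ih z) (massiveMatrix_inv_apply_nonneg hν x z)
      _ = 2 ^ n * (S⁻¹ *ᵥ W) x := by
          rw [Matrix.mulVec, dotProduct, Finset.mul_sum]
          exact Finset.sum_congr rfl fun z _ => by ring
      _ ≤ 2 ^ n * (2 * W x) := mul_le_mul_of_nonneg_left (hone x) (by positivity)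
      _ = 2 ^ (n + 1) * W x := by ring

/-- The rows of the powers of the resolvent are summable against exponential weights. -/
theorem sum_massiveMatrix_inv_pow_mul_exp_le {d N M : ℕ} (hN : 0 < N) {β ν : ℝ}
    (hν : 0 ≤ ν) (hβ : 0 ≤ β) (hβ1 : β ≤ 1) (hβd : 4 * d * β ^ 2 ≤ 1) (n : ℕ)
    (x : Fin d → Fin (M + 1)) :
    ∑ z, ((massiveMatrix d N M ν)⁻¹ ^ n) x z *
      Real.exp (β * taxi (sitePos N x) (sitePos N z)) ≤ 2 ^ (n + d) := by
  calc ∑ z, ((massiveMatrix d N M ν)⁻¹ ^ n) x z *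
        Real.exp (β * taxi (sitePos N x) (sitePos N z))
      ≤ ∑ z, ((massiveMatrix d N M ν)⁻¹ ^ n) x z * (2 ^ d * coshWeight N β x z) :=
        Finset.sum_le_sum fun z _ => mul_le_mul_of_nonneg_left (exp_taxi_le_coshWeight N hβ x z)
          (massiveMatrix_inv_pow_apply_nonneg hν n x z)
    _ = 2 ^ d * ((massiveMatrix d N M ν)⁻¹ ^ n *ᵥ coshWeight N β x) x := by
        rw [Matrix.mulVec, dotProduct, Finset.mul_sum]
        exact Finset.sum_congr rfl fun z _ => by ring
    _ ≤ 2 ^ d * (2 ^ n * coshWeight N β x x) := mul_le_mul_of_nonneg_left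
        (massiveMatrix_inv_pow_mulVec_coshWeight_le hN hν hβ hβ1 hβd x n x) (by positivity)
    _ = 2 ^ (n + d) := by
        have : coshWeight N β x x = 1 := by simp [coshWeight]
        rw [this]
        ring

/-! ### Pointwise decay of the solution with a block source -/

/-- The indicator function of the unit block with corner `y`. -/
def blockIndicator {d M : ℕ} (N : ℕ) (y : Fin d → ℕ) (x : Fin d → Fin (M + 1)) : ℝ :=
  if ∀ μ, (x μ : ℕ) / N = y μ then 1 else 0

theorem taxi_sitePos_le {d N M : ℕ} (hN : 0 < N) {y : Fin d → ℕ} {x : Fin d → Fin (M + 1)}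
    (h : ∀ μ, (x μ : ℕ) / N = y μ) : taxi (sitePos N x) (fun i => (y i : ℝ)) ≤ d := by
  have hN' : (0 : ℝ) < N := by exact_mod_cast hN
  calc taxi (sitePos N x) (fun i => (y i : ℝ)) ≤ ∑ _i : Fin d, (1 : ℝ) := by
        refine Finset.sum_le_sum fun i _ => ?_
        have h1 := Nat.div_add_mod (x i : ℕ) N
        rw [h i] at h1
        have h2 := Nat.mod_lt (x i : ℕ) hN
        have h3 : N * y i ≤ (x i : ℕ) := by omega
        have h4 : (x i : ℕ) ≤ N * y i + N := by omega
        have h3' : (N : ℝ) * y i ≤ ((x i : ℕ) : ℝ) := by exact_mod_cast h3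
        have h4' : ((x i : ℕ) : ℝ) ≤ (N : ℝ) * y i + N := by exact_mod_cast h4
        have h5 : sitePos N x i - y i = (N : ℝ)⁻¹ * (((x i : ℕ) : ℝ) - N * y i) := by
          rw [sitePos]
          field_simp
        rw [h5, abs_of_nonneg (mul_nonneg (by positivity) (by linarith)), inv_mul_le_iff₀ hN']
        linarith
    _ = d := by simp

theorem sum_blockIndicator_le {d N M : ℕ} (hN : 0 < N) (y : Fin d → ℕ) :
    ∑ x : Fin d → Fin (M + 1), blockIndicator N y x ≤ (N : ℝ) ^ d := by
  have h : ∀ x : Fin d → Fin (M + 1), blockIndicator N y x =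
      ∏ μ, if (x μ : ℕ) / N = y μ then (1 : ℝ) else 0 := by
    intro x
    rw [Fintype.prod_ite_zero, blockIndicator]
    simp
  simp only [h]
  rw [← Fintype.prod_sum fun (μ : Fin d) (t : Fin (M + 1)) =>
    if (t : ℕ) / N = y μ then (1 : ℝ) else 0]
  calc ∏ μ, ∑ t : Fin (M + 1), (if (t : ℕ) / N = y μ then (1 : ℝ) else 0)
      ≤ ∏ _μ : Fin d, (N : ℝ) := by
        refine Finset.prod_le_prod (fun μ _ => Finset.sum_nonneg fun t _ => by positivity)
          fun μ _ => ?_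
        rw [← Finset.sum_filter, Finset.sum_const, nsmul_eq_mul, mul_one]
        exact_mod_cast card_block_le hN _
    _ = (N : ℝ) ^ d := by simp

section Decay

variable {d N K : ℕ} {α b γ ν : ℝ} {y : Fin d → ℕ} {u : (Fin d → Fin (N * K + 1)) → ℝ}

/-- The Combes–Thomas estimate for a block source; the factor `N ^ d` is the number of sites of a
block. -/
theorem sum_weighted_solution_sq_le (hN : 0 < N) (hγ : 0 < γ) (hb : 0 ≤ b) (hα : 0 ≤ α)
    (hα1 : α ≤ 1) (hαd : α * d ≤ 1) (hgap : γ • 1 ≤ greenMatrix d N (N * K) ν b)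
    (hrow : 2 * d * α ^ 2 + b * (α * d) ^ 2 ≤ γ / 2)
    (hu : greenMatrix d N (N * K) ν b *ᵥ u = blockIndicator N y) :
    ∑ x, (Real.exp (α * taxi (sitePos N x) (fun i => (y i : ℝ))) * u x) ^ 2 ≤
      (2 * Real.exp 1 / γ) ^ 2 * (N : ℝ) ^ d := by
  have hsymm : (greenMatrix d N (N * K) ν b).IsSymm := by
    refine ((isSymm_of_nonneg (cubeMatrix_nonneg d N (N * K))).add
      (Matrix.isSymm_one.smul ν)).add ((isSymm_of_nonneg (cubeBlockMatrix_nonneg d N K)).smul b)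
  have h1 := sum_weighted_sq_le hsymm (fun x => α * taxi (sitePos N x) (fun i => (y i : ℝ))) hγ
    hgap (fun x => (sum_greenMatrix_mul_cosh_le hN ν hα hα1 hαd hb _ x).trans hrow) u
  refine h1.trans ?_
  rw [hu]
  have h2 : ∑ x : Fin d → Fin (N * K + 1),
      (Real.exp (α * taxi (sitePos N x) (fun i => (y i : ℝ))) * blockIndicator N y x) ^ 2 ≤
      Real.exp 1 ^ 2 * (N : ℝ) ^ d := by
    calc ∑ x : Fin d → Fin (N * K + 1),
        (Real.exp (α * taxi (sitePos N x) (fun i => (y i : ℝ))) * blockIndicator N y x) ^ 2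
        ≤ ∑ x : Fin d → Fin (N * K + 1), Real.exp 1 ^ 2 * blockIndicator N y x := by
          refine Finset.sum_le_sum fun x _ => ?_
          rw [blockIndicator]
          split_ifs with hx
          · rw [mul_one, mul_one]
            refine pow_le_pow_left₀ (Real.exp_pos _).le (Real.exp_le_exp.mpr ?_) 2
            exact (mul_le_mul_of_nonneg_left (taxi_sitePos_le hN hx) hα).trans hαd
          · simp
      _ ≤ _ := by
          rw [← Finset.mul_sum]
          exact mul_le_mul_of_nonneg_left (sum_blockIndicator_le hN y) (by positivity)
  refine (mul_le_mul_of_nonneg_left h2 (by positivity)).trans_eq ?_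
  field_simp
  ring

/-- The block averages inherit the decay of the `ℓ²` norms over the blocks. -/
theorem abs_cubeBlockMatrix_mulVec_le (hN : 0 < N) (hα : 0 ≤ α) (hαd : α * d ≤ 1) {C : ℝ}
    (hC : 0 ≤ C) (q : Fin d → ℝ)
    (hL2 : ∑ x, (Real.exp (α * taxi (sitePos N x) q) * u x) ^ 2 ≤ C ^ 2 * (N : ℝ) ^ d)
    (x : Fin d → Fin (N * K + 1)) :
    |(cubeBlockMatrix d N (N * K) *ᵥ u) x| ≤
      C * Real.exp 1 * Real.exp (-(α * taxi (sitePos N x) q)) := by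
  have hN' : (0 : ℝ) < N := by exact_mod_cast hN
  set w : (Fin d → Fin (N * K + 1)) → ℝ := fun x => α * taxi (sitePos N x) q with hw
  refine abs_le_of_sq_le_sq ?_ (by positivity)
  have hCS : (cubeBlockMatrix d N (N * K) *ᵥ u) x ^ 2 ≤
      (∑ z, cubeBlockMatrix d N (N * K) x z) *
      ∑ z, cubeBlockMatrix d N (N * K) x z * u z ^ 2 := by
    refine Finset.sum_sq_le_sum_mul_sum_of_sq_le_mul Finset.univ
      (fun z _ => cubeBlockMatrix_apply_nonneg x z)
      (fun z _ => mul_nonneg (cubeBlockMatrix_apply_nonneg x z) (sq_nonneg _)) fun z _ => le_of_eq ?_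
    ring
  have hterm : ∀ z, cubeBlockMatrix d N (N * K) x z * u z ^ 2 ≤
      ((N : ℝ)⁻¹) ^ d * (Real.exp 1 * Real.exp (-w x)) ^ 2 * (Real.exp (w z) * u z) ^ 2 := by
    intro z
    rw [cubeBlockMatrix_apply]
    split_ifs with hz
    · have h1 : w x ≤ 1 + w z := by
        have h2 := taxi_triangle (sitePos N x) (sitePos N z) q
        have h3 := taxi_le_of_block hN hz
        simp only [hw]
        nlinarith [mul_le_mul_of_nonneg_left h2 hα, mul_le_mul_of_nonneg_left h3 hα]
      have h4 : 1 ≤ Real.exp 1 * Real.exp (-w x) * Real.exp (w z) := by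
        rw [← Real.exp_add, ← Real.exp_add]
        exact Real.one_le_exp (by linarith)
      have h5 : u z ^ 2 ≤ (Real.exp 1 * Real.exp (-w x) * Real.exp (w z)) ^ 2 * u z ^ 2 :=
        le_mul_of_one_le_left (sq_nonneg _) (one_le_pow₀ h4)
      calc ((N : ℝ)⁻¹) ^ d * u z ^ 2
          ≤ ((N : ℝ)⁻¹) ^ d *
            ((Real.exp 1 * Real.exp (-w x) * Real.exp (w z)) ^ 2 * u z ^ 2) :=
            mul_le_mul_of_nonneg_left h5 (by positivity)
        _ = _ := by ring
    · rw [zero_mul]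
      positivity
  calc (cubeBlockMatrix d N (N * K) *ᵥ u) x ^ 2
      ≤ 1 * ∑ z, cubeBlockMatrix d N (N * K) x z * u z ^ 2 := by
        refine hCS.trans (mul_le_mul_of_nonneg_right (sum_cubeBlockMatrix_le_one hN x) ?_)
        exact Finset.sum_nonneg fun z _ =>
          mul_nonneg (cubeBlockMatrix_apply_nonneg x z) (sq_nonneg _)
    _ ≤ ((N : ℝ)⁻¹) ^ d * (Real.exp 1 * Real.exp (-w x)) ^ 2 *
        ∑ z, (Real.exp (w z) * u z) ^ 2 := by
        rw [one_mul, Finset.mul_sum]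
        exact Finset.sum_le_sum fun z _ => hterm z
    _ ≤ ((N : ℝ)⁻¹) ^ d * (Real.exp 1 * Real.exp (-w x)) ^ 2 * (C ^ 2 * (N : ℝ) ^ d) :=
        mul_le_mul_of_nonneg_left hL2 (by positivity)
    _ = ((N : ℝ)⁻¹ * N) ^ d * (C * Real.exp 1 * Real.exp (-w x)) ^ 2 := by
        rw [mul_pow]
        ring
    _ = (C * Real.exp 1 * Real.exp (-w x)) ^ 2 := by
        rw [inv_mul_cancel₀ hN'.ne', one_pow, one_mul]

theorem exp_mul_taxi_le {d : ℕ} {α : ℝ} (hα : 0 ≤ α) (p q r : Fin d → ℝ) :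
    Real.exp (-(α * taxi q r)) ≤ Real.exp (-(α * taxi p r)) * Real.exp (α * taxi p q) := by
  rw [← Real.exp_add, Real.exp_le_exp]
  nlinarith [mul_le_mul_of_nonneg_left (taxi_triangle p q r) hα]

/-- The powers of the resolvent preserve pointwise exponential decay. -/
theorem abs_massiveMatrix_inv_pow_mulVec_le (hN : 0 < N) (hν : 0 ≤ ν) (hα : 0 ≤ α) (hα1 : α ≤ 1)
    (hαd : 4 * d * α ^ 2 ≤ 1) {C : ℝ} (q : Fin d → ℝ)
    {g : (Fin d → Fin (N * K + 1)) → ℝ}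
    (hg : ∀ x, |g x| ≤ C * Real.exp (-(α * taxi (sitePos N x) q))) (n : ℕ)
    (x : Fin d → Fin (N * K + 1)) :
    |((massiveMatrix d N (N * K) ν)⁻¹ ^ n *ᵥ g) x| ≤
      C * 2 ^ (n + d) * Real.exp (-(α * taxi (sitePos N x) q)) := by
  have hC : 0 ≤ C := nonneg_of_mul_nonneg_left ((abs_nonneg _).trans (hg x)) (Real.exp_pos _)
  set k := (massiveMatrix d N (N * K) ν)⁻¹ ^ n with hk
  have hk0 : ∀ z, 0 ≤ k x z := fun z => massiveMatrix_inv_pow_apply_nonneg hν n x z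
  calc |(k *ᵥ g) x| ≤ ∑ z, |k x z * g z| := Finset.abs_sum_le_sum_abs _ _
    _ ≤ ∑ z, C * Real.exp (-(α * taxi (sitePos N x) q)) *
        (k x z * Real.exp (α * taxi (sitePos N x) (sitePos N z))) := by
        refine Finset.sum_le_sum fun z _ => ?_
        rw [abs_mul, abs_of_nonneg (hk0 z)]
        calc k x z * |g z| ≤ k x z * (C * (Real.exp (-(α * taxi (sitePos N x) q)) *
              Real.exp (α * taxi (sitePos N x) (sitePos N z)))) :=
              mul_le_mul_of_nonneg_left ((hg z).trans
                (mul_le_mul_of_nonneg_left (exp_mul_taxi_le hα _ _ _) hC)) (hk0 z)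
          _ = _ := by ring
    _ ≤ C * Real.exp (-(α * taxi (sitePos N x) q)) * 2 ^ (n + d) := by
        rw [← Finset.mul_sum]
        exact mul_le_mul_of_nonneg_left
          (sum_massiveMatrix_inv_pow_mul_exp_le hN hν hα hα1 hαd n x) (by positivity)
    _ = _ := by ring

/-- The `d`-th power of the resolvent turns weighted `ℓ²` decay into pointwise decay. -/
theorem abs_massiveMatrix_inv_pow_mulVec_le_of_sq (hN : 0 < N) (hK : 0 < K) (hν : 0 ≤ ν)
    (hα : 0 ≤ α) (hα1 : 2 * α ≤ 1) (hαd : 4 * d * (2 * α) ^ 2 ≤ 1) {C : ℝ} (hC : 0 ≤ C)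
    (q : Fin d → ℝ)
    (hL2 : ∑ x, (Real.exp (α * taxi (sitePos N x) q) * u x) ^ 2 ≤ C ^ 2 * (N : ℝ) ^ d)
    (x : Fin d → Fin (N * K + 1)) :
    |((massiveMatrix d N (N * K) ν)⁻¹ ^ d *ᵥ u) x| ≤
      C * 8 ^ d * Real.exp (-(α * taxi (sitePos N x) q)) := by
  have hN' : (0 : ℝ) < N := by exact_mod_cast hN
  set k := (massiveMatrix d N (N * K) ν)⁻¹ ^ d with hk
  have hk0 : ∀ z, 0 ≤ k x z := fun z => massiveMatrix_inv_pow_apply_nonneg hν d x z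
  set D : (Fin d → Fin (N * K + 1)) → ℝ := fun z => taxi (sitePos N x) (sitePos N z) with hD
  set w : (Fin d → Fin (N * K + 1)) → ℝ := fun x => α * taxi (sitePos N x) q with hw
  have h1 : |(k *ᵥ u) x| ≤ Real.exp (-w x) *
      ∑ z, (k x z * Real.exp (α * D z)) * (Real.exp (w z) * |u z|) := by
    refine (Finset.abs_sum_le_sum_abs _ _).trans ?_
    rw [Finset.mul_sum]
    refine Finset.sum_le_sum fun z _ => ?_
    have h2 := exp_mul_taxi_le hα (sitePos N x) (sitePos N z) q
    have h3 : 1 ≤ Real.exp (-w x) * Real.exp (α * D z) * Real.exp (w z) := by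
      calc (1 : ℝ) = Real.exp (-w z) * Real.exp (w z) := by rw [← Real.exp_add]; simp
        _ ≤ _ := mul_le_mul_of_nonneg_right h2 (Real.exp_pos _).le
    rw [abs_mul, abs_of_nonneg (hk0 z)]
    calc k x z * |u z| ≤ (k x z * |u z|) *
          (Real.exp (-w x) * Real.exp (α * D z) * Real.exp (w z)) :=
          le_mul_of_one_le_right (mul_nonneg (hk0 z) (abs_nonneg _)) h3
      _ = _ := by ring
  have h2 : (∑ z, (k x z * Real.exp (α * D z)) * (Real.exp (w z) * |u z|)) ^ 2 ≤
      (C * 8 ^ d) ^ 2 := by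
    -- One factor of the kernel is bounded pointwise, the other one is summed with weight `2 α`.
    have hA : ∑ z, (k x z * Real.exp (α * D z)) ^ 2 ≤ (2 * (N : ℝ)⁻¹) ^ d * 2 ^ (d + d) := by
      calc ∑ z, (k x z * Real.exp (α * D z)) ^ 2
          ≤ ∑ z, (2 * (N : ℝ)⁻¹) ^ d * (k x z * Real.exp (2 * α * D z)) := by
            refine Finset.sum_le_sum fun z _ => ?_
            have h3 : k x z ≤ (2 * (N : ℝ)⁻¹) ^ d :=
              (le_abs_self _).trans (abs_massiveMatrix_inv_pow_apply_le hN hK hν x z)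
            have h4 : Real.exp (2 * α * D z) = Real.exp (α * D z) ^ 2 := by
              rw [← Real.exp_nat_mul]
              congr 1
              push_cast
              ring
            rw [h4, mul_pow, sq (k x z), mul_assoc]
            exact mul_le_mul_of_nonneg_right h3 (mul_nonneg (hk0 z) (sq_nonneg _))
        _ ≤ _ := by
            rw [← Finset.mul_sum]
            exact mul_le_mul_of_nonneg_left (sum_massiveMatrix_inv_pow_mul_exp_le hN hν
              (by positivity) hα1 hαd d x) (by positivity)
    have hB : ∑ z, (Real.exp (w z) * |u z|) ^ 2 ≤ C ^ 2 * (N : ℝ) ^ d := by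
      refine le_of_eq_of_le (Finset.sum_congr rfl fun z _ => ?_) hL2
      rw [mul_pow, sq_abs, mul_pow]
    calc (∑ z, (k x z * Real.exp (α * D z)) * (Real.exp (w z) * |u z|)) ^ 2
        ≤ (∑ z, (k x z * Real.exp (α * D z)) ^ 2) * ∑ z, (Real.exp (w z) * |u z|) ^ 2 :=
          Finset.sum_mul_sq_le_sq_mul_sq _ _ _
      _ ≤ ((2 * (N : ℝ)⁻¹) ^ d * 2 ^ (d + d)) * (C ^ 2 * (N : ℝ) ^ d) :=
          mul_le_mul hA hB (Finset.sum_nonneg fun _ _ => sq_nonneg _) (by positivity)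
      _ = C ^ 2 * 8 ^ d * ((N : ℝ)⁻¹ * N) ^ d := by
          rw [mul_pow, mul_pow, pow_add, show (8 : ℝ) = 2 * 2 * 2 by norm_num, mul_pow, mul_pow]
          ring
      _ = C ^ 2 * 8 ^ d := by rw [inv_mul_cancel₀ hN'.ne', one_pow, mul_one]
      _ ≤ (C * 8 ^ d) ^ 2 := by
          rw [mul_pow]
          refine mul_le_mul_of_nonneg_left ?_ (by positivity)
          exact le_self_pow₀ (one_le_pow₀ (by norm_num)) (by norm_num)
  have h3 := (le_abs_self _).trans (abs_le_of_sq_le_sq h2 (by positivity))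
  calc |(k *ᵥ u) x| ≤ Real.exp (-w x) * (C * 8 ^ d) :=
        h1.trans (mul_le_mul_of_nonneg_left h3 (Real.exp_pos _).le)
    _ = _ := by ring

/-- If `S u = g + u`, then `u = ∑_{j < n} S^{-(j+1)} g + S^{-n} u`. -/
theorem eq_sum_inv_pow_add {X : Type*} [Fintype X] [DecidableEq X] {S : Matrix X X ℝ}
    (hS : S⁻¹ * S = 1) {u g : X → ℝ} (h : S *ᵥ u = g + u) (n : ℕ) :
    u = ∑ j ∈ Finset.range n, S⁻¹ ^ (j + 1) *ᵥ g + S⁻¹ ^ n *ᵥ u := by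
  have h1 : u = S⁻¹ *ᵥ g + S⁻¹ *ᵥ u := by
    rw [← Matrix.mulVec_add, ← h, Matrix.mulVec_mulVec, hS, Matrix.one_mulVec]
  induction n with
  | zero => simp
  | succ n ih =>
    have h2 : S⁻¹ ^ n *ᵥ u = S⁻¹ ^ (n + 1) *ᵥ g + S⁻¹ ^ (n + 1) *ᵥ u := by
      conv_lhs => rw [h1]
      rw [Matrix.mulVec_add, Matrix.mulVec_mulVec, Matrix.mulVec_mulVec, pow_succ]
    rw [Finset.sum_range_succ, add_assoc, ← h2]
    exact ih

/-- The constant of the pointwise estimate: the first term bounds `∑_{j < d} R ^ (j + 1) g`, the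
second one `R ^ d u`, where `R = (1 + ν - Δ)⁻¹`. -/
def decayConst (d : ℕ) (b γ : ℝ) : ℝ :=
  (Real.exp 1 + b * (2 * Real.exp 1 / γ * Real.exp 1)) * (d * 4 ^ d)
    + 2 * Real.exp 1 / γ * 8 ^ d

/-- The solution of `(-Δ + ν + b Q^* Q) u = 1_{B(y)}` decays exponentially away from `y`. -/
theorem abs_solution_le {M : ℕ} {u : (Fin d → Fin (M + 1)) → ℝ} (hd : 1 ≤ d) (hN : 0 < N)
    (hK : 0 < K) (hM : M = N * K) (hν : 0 ≤ ν) (hγ : 0 < γ) (hb : 0 ≤ b) (hα : 0 ≤ α)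
    (hαd : 4 * α * d ≤ 1) (hgap : γ • 1 ≤ greenMatrix d N M ν b)
    (hrow : 2 * d * α ^ 2 + b * (α * d) ^ 2 ≤ γ / 2)
    (hu : greenMatrix d N M ν b *ᵥ u = blockIndicator N y) (x : Fin d → Fin (M + 1)) :
    |u x| ≤ decayConst d b γ * Real.exp (-(α * taxi (sitePos N x) (fun i => (y i : ℝ)))) := by
  subst hM
  have hd' : (1 : ℝ) ≤ d := by exact_mod_cast hd
  have hαd1 : α * d ≤ 1 := by nlinarith [mul_nonneg hα (zero_le_one.trans hd')]
  have hα4 : 4 * α ≤ 1 := by nlinarith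
  have hα2 : 4 * d * (2 * α) ^ 2 ≤ 1 := by
    have h1 : 4 * (d : ℝ) * (2 * α) ^ 2 = (4 * α * d) * (4 * α) := by ring
    rw [h1]
    exact mul_le_one₀ hαd (by positivity) hα4
  have hα3 : 4 * d * α ^ 2 ≤ 1 := by nlinarith [mul_nonneg (zero_le_one.trans hd') (sq_nonneg α)]
  set q : Fin d → ℝ := fun i => (y i : ℝ) with hq
  set C := 2 * Real.exp 1 / γ with hC
  have hC0 : 0 ≤ C := by positivity
  have hL2 := sum_weighted_solution_sq_le hN hγ hb hα (by linarith) hαd1 hgap hrow hu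
  set g : (Fin d → Fin (N * K + 1)) → ℝ :=
    blockIndicator N y - b • (cubeBlockMatrix d N (N * K) *ᵥ u) with hg
  have hSu : massiveMatrix d N (N * K) ν *ᵥ u = g + u := by
    rw [hg, ← hu, greenMatrix, massiveMatrix]
    simp only [Matrix.add_mulVec, Matrix.smul_mulVec, Matrix.one_mulVec]
    module
  have hgb : ∀ z, |g z| ≤ (Real.exp 1 + b * (C * Real.exp 1)) *
      Real.exp (-(α * taxi (sitePos N z) q)) := by
    intro z
    have h1 : |blockIndicator N y z| ≤ Real.exp 1 * Real.exp (-(α * taxi (sitePos N z) q)) := by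
      rw [blockIndicator]
      split_ifs with hz
      · rw [abs_one, ← Real.exp_add]
        refine Real.one_le_exp ?_
        linarith [mul_le_mul_of_nonneg_left (taxi_sitePos_le hN hz) hα]
      · rw [abs_zero]
        positivity
    have h2 := abs_cubeBlockMatrix_mulVec_le hN hα hαd1 hC0 q hL2 z
    calc |g z| ≤ |blockIndicator N y z| + |b * (cubeBlockMatrix d N (N * K) *ᵥ u) z| :=
          abs_sub _ _
      _ ≤ Real.exp 1 * Real.exp (-(α * taxi (sitePos N z) q)) +
          b * (C * Real.exp 1 * Real.exp (-(α * taxi (sitePos N z) q))) := by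
          rw [abs_mul, abs_of_nonneg hb]
          exact add_le_add h1 (mul_le_mul_of_nonneg_left h2 hb)
      _ = _ := by ring
  have hC1 : 0 ≤ Real.exp 1 + b * (C * Real.exp 1) := by positivity
  set C1 := Real.exp 1 + b * (C * Real.exp 1) with hC1'
  have hE := Real.exp_pos (-(α * taxi (sitePos N x) q))
  set E := Real.exp (-(α * taxi (sitePos N x) q)) with hE'
  have hsum : |∑ j ∈ Finset.range d, ((massiveMatrix d N (N * K) ν)⁻¹ ^ (j + 1) *ᵥ g) x| ≤
      C1 * (d * 4 ^ d) * E := by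
    calc |∑ j ∈ Finset.range d, ((massiveMatrix d N (N * K) ν)⁻¹ ^ (j + 1) *ᵥ g) x|
        ≤ ∑ j ∈ Finset.range d, C1 * 4 ^ d * E := by
          refine (Finset.abs_sum_le_sum_abs _ _).trans (Finset.sum_le_sum fun j hj => ?_)
          refine (abs_massiveMatrix_inv_pow_mulVec_le hN hν hα (by linarith) hα3 q hgb (j + 1)
            x).trans ?_
          refine mul_le_mul_of_nonneg_right (mul_le_mul_of_nonneg_left ?_ hC1) hE.le
          have hj := Finset.mem_range.mp hj
          calc (2 : ℝ) ^ (j + 1 + d) ≤ 2 ^ (2 * d) :=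
                pow_le_pow_right₀ (by norm_num) (by omega)
            _ = 4 ^ d := by rw [pow_mul]; norm_num
      _ = C1 * (d * 4 ^ d) * E := by
          rw [Finset.sum_const, Finset.card_range, nsmul_eq_mul]
          ring
  have hlast := abs_massiveMatrix_inv_pow_mulVec_le_of_sq hN hK hν hα (by linarith) hα2 hC0 q hL2 x
  have hux := congrFun (eq_sum_inv_pow_add (massiveMatrix_inv_mul d N (N * K) hν) hSu d) x
  rw [Pi.add_apply, Finset.sum_apply] at hux
  rw [hux]
  refine (abs_add_le _ _).trans ((add_le_add hsum hlast).trans_eq ?_)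
  rw [decayConst]
  ring

end Decay

/-! ### The complex operators in terms of real matrices -/

theorem neumannLaplacian_ofReal (d L k m : ℕ) (u : Fine d L m → ℝ) (x : Fine d L m) :
    neumannLaplacian d (spacing L k) (L ^ m) (fun z => (u z : ℂ)) x =
      -((cubeMatrix d (L ^ k) (L ^ m) *ᵥ u) x : ℂ) := by
  rw [cubeMatrix_mulVec, Complex.ofReal_sum, ← Finset.sum_neg_distrib]
  simp only [neumannLaplacian, LinearMap.coe_mk, AddHom.coe_mk]
  refine Finset.sum_congr rfl fun μ _ => ?_
  simp only [intervalLaplacian, LinearMap.coe_mk, AddHom.coe_mk, Function.update_eq_self, spacing]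
  push_cast
  rw [inv_pow, div_inv_eq_mul]
  ring

theorem blockLabel_eq_iff {d L k m : ℕ} (x : Fine d L m) (y : Coarse d L k m) :
    blockLabel x = y ↔ ∀ μ, (x μ : ℕ) / L ^ k = (y μ : ℕ) := by
  simp only [funext_iff, Fin.ext_iff, blockLabel]

theorem averagingAdjoint_averaging_ofReal {L : ℕ} (hL : 0 < L) (d k m : ℕ) (u : Fine d L m → ℝ)
    (x : Fine d L m) :
    averagingAdjoint d L k m (averaging d L k m fun z => (u z : ℂ)) x =
      ((cubeBlockMatrix d (L ^ k) (L ^ m) *ᵥ u) x : ℂ) := by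
  have hb : (block (blockLabel x : Coarse d L k m) : Finset (Fine d L m)) =
      Finset.univ.filter fun x' => ∀ μ, (x' μ : ℕ) / L ^ k = (x μ : ℕ) / L ^ k := by
    ext x'
    rw [mem_block_iff hL, blockLabel_eq_iff]
    simp [blockLabel]
  simp only [averagingAdjoint, averaging, LinearMap.coe_mk, AddHom.coe_mk]
  rw [hb, Matrix.mulVec, dotProduct, Finset.mul_sum, Complex.ofReal_sum, Finset.sum_filter]
  refine Finset.sum_congr rfl fun x' _ => ?_
  rw [cubeBlockMatrix_apply]
  split_ifs
  · push_cast
    rw [inv_pow, ← pow_mul]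
  · simp

theorem greenOperator_ofReal {L : ℕ} (hL : 0 < L) (d : ℕ) (a μ₀ : ℝ) (k m : ℕ)
    (u : Fine d L m → ℝ) (x : Fine d L m) :
    greenOperator d a μ₀ L k m (fun z => (u z : ℂ)) x =
      ((greenMatrix d (L ^ k) (L ^ m) ((L : ℝ) ^ (2 * k) * μ₀) (aCoeff a L k) *ᵥ u) x : ℂ) := by
  have h1 := neumannLaplacian_ofReal d L k m u x
  have h2 := averagingAdjoint_averaging_ofReal hL d k m u x
  simp only [greenOperator, LinearMap.add_apply, LinearMap.neg_apply, LinearMap.smul_apply,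
    LinearMap.id_apply, LinearMap.comp_apply, Pi.add_apply, Pi.neg_apply, Pi.smul_apply,
    smul_eq_mul, h1, h2]
  simp only [greenMatrix, Matrix.add_mulVec, Matrix.smul_mulVec, Matrix.one_mulVec, Pi.add_apply,
    Pi.smul_apply, smul_eq_mul]
  push_cast
  ring

theorem isUnit_of_smul_one_le {X : Type*} [Fintype X] [DecidableEq X] {T : Matrix X X ℝ} {γ : ℝ}
    (hγ : 0 < γ) (h : γ • 1 ≤ T) : IsUnit T := by
  have h1 : T.PosDef := by
    have := (Matrix.PosDef.one.smul hγ).add_posSemidef (Matrix.le_iff.mp h)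
    rwa [add_sub_cancel] at this
  exact h1.isUnit

/-- An endomorphism acting on real functions as an invertible real matrix is invertible. -/
theorem isUnit_of_ofReal {X : Type*} [Fintype X] [DecidableEq X] {T : Matrix X X ℝ}
    (hT : IsUnit T) {G : Module.End ℂ (X → ℂ)}
    (h : ∀ (u : X → ℝ) x, G (fun z => (u z : ℂ)) x = ((T *ᵥ u) x : ℂ)) : IsUnit G := by
  have hinj := Matrix.mulVec_injective_iff_isUnit.mpr hT
  rw [Module.End.isUnit_iff]
  have hG : Function.Injective G := by
    rw [injective_iff_map_eq_zero]
    intro f hf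
    have hsplit : f = (fun z => ((f z).re : ℂ)) + Complex.I • fun z => ((f z).im : ℂ) := by
      funext z
      simp [mul_comm Complex.I]
    have hval : ∀ x, (T *ᵥ fun z => (f z).re) x = 0 ∧ (T *ᵥ fun z => (f z).im) x = 0 := by
      intro x
      have h1 := congrFun hf x
      rw [hsplit, map_add, map_smul, Pi.add_apply, Pi.smul_apply, h, h, smul_eq_mul,
        Pi.zero_apply, Complex.ext_iff] at h1
      simpa using h1
    have hre : (fun z => (f z).re) = 0 := hinj (by
      rw [Matrix.mulVec_zero]; exact funext fun x => (hval x).1)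
    have him : (fun z => (f z).im) = 0 := hinj (by
      rw [Matrix.mulVec_zero]; exact funext fun x => (hval x).2)
    funext z
    exact Complex.ext (congrFun hre z) (congrFun him z)
  exact ⟨hG, LinearMap.injective_iff_surjective.mp hG⟩

theorem spacing_ne_zero {L : ℕ} (hL : 0 < L) (k : ℕ) : spacing L k ≠ 0 := by
  unfold spacing
  positivity

theorem averagingAdjoint_latticeDelta (d L k m : ℕ) (y : Coarse d L k m) :
    averagingAdjoint d L k m (latticeDelta d 1 y) =
      fun x => (blockIndicator (L ^ k) (fun i => (y i : ℕ)) x : ℂ) := by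
  funext x
  simp only [averagingAdjoint, LinearMap.coe_mk, AddHom.coe_mk, latticeDelta, Complex.ofReal_one,
    one_pow, inv_one, Pi.single_apply, blockLabel_eq_iff, blockIndicator]
  split_ifs <;> simp

/-- The kernel of `G_k Q^*` is the solution of the real equation with source the indicator function
of a block. -/
theorem latticeKernel_greenAveragingAdjoint {L : ℕ} (hL : 0 < L) (d : ℕ) (a μ₀ : ℝ) (k m : ℕ)
    (hT : IsUnit (greenMatrix d (L ^ k) (L ^ m) ((L : ℝ) ^ (2 * k) * μ₀) (aCoeff a L k)))
    (y : Coarse d L k m) :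
    ∃ u : Fine d L m → ℝ,
      greenMatrix d (L ^ k) (L ^ m) ((L : ℝ) ^ (2 * k) * μ₀) (aCoeff a L k) *ᵥ u =
        blockIndicator (L ^ k) (fun i => (y i : ℕ)) ∧
      ∀ x, latticeKernel d (spacing L k) 1 (greenAveragingAdjoint d a μ₀ L k m) x y =
        (u x : ℂ) := by
  set T := greenMatrix d (L ^ k) (L ^ m) ((L : ℝ) ^ (2 * k) * μ₀) (aCoeff a L k) with hTdef
  have hTT : T * T⁻¹ = 1 := Matrix.mul_nonsing_inv _ ((Matrix.isUnit_iff_isUnit_det _).mp hT)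
  set F : Fine d L m → ℝ := blockIndicator (L ^ k) (fun i => (y i : ℕ)) with hF
  have hu : T *ᵥ (T⁻¹ *ᵥ F) = F := by rw [Matrix.mulVec_mulVec, hTT, Matrix.one_mulVec]
  refine ⟨T⁻¹ *ᵥ F, hu, fun x => ?_⟩
  have hG : IsUnit (greenOperator d a μ₀ L k m) :=
    isUnit_of_ofReal hT (greenOperator_ofReal hL d a μ₀ k m)
  have h1 : greenOperator d a μ₀ L k m (fun z => ((T⁻¹ *ᵥ F) z : ℂ)) = fun z => (F z : ℂ) := by
    funext z
    rw [greenOperator_ofReal hL, hu]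
  rw [latticeKernel, latticeInner_latticeDelta d (spacing_ne_zero hL k), greenAveragingAdjoint,
    LinearMap.comp_apply, averagingAdjoint_latticeDelta, ← hF, ← h1, greenFunction,
    ← Module.End.mul_apply, Ring.inverse_mul_cancel _ hG, Module.End.one_apply]

theorem latticeKernel_hOperator (d L k m : ℕ) (a μ₀ : ℝ) (x : Fine d L m) (y : Coarse d L k m) :
    latticeKernel d (spacing L k) 1 (hOperator d a μ₀ L k m) x y =
      (aCoeff a L k : ℂ) *
        latticeKernel d (spacing L k) 1 (greenAveragingAdjoint d a μ₀ L k m) x y := by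
  simp only [latticeKernel, hOperator, LinearMap.smul_apply, latticeInner, Pi.smul_apply,
    smul_eq_mul, Finset.mul_sum]
  exact Finset.sum_congr rfl fun z _ => by ring

theorem dist_position_le_taxi {d L k m : ℕ} (x : Fine d L m) (y : Coarse d L k m) :
    dist (position (spacing L k) x) (position 1 y) ≤
      taxi (sitePos (L ^ k) x) (fun i => ((y i : ℕ) : ℝ)) := by
  rw [EuclideanSpace.dist_eq]
  refine Real.sqrt_le_iff.mpr ⟨taxi_nonneg _ _, ?_⟩
  refine le_trans (le_of_eq ?_) (Finset.sum_sq_le_sq_sum_of_nonneg fun i _ => abs_nonneg _)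
  refine Finset.sum_congr rfl fun i _ => ?_
  simp [position, sitePos, spacing, Real.dist_eq]

theorem aCoeff_bounds {a : ℝ} (ha : 0 ≤ a) {L k : ℕ} (hL : 1 < L) (hk : 1 ≤ k) :
    3 / 4 * a ≤ aCoeff a L k ∧ aCoeff a L k ≤ a := by
  have hL2 : (2 : ℝ) ≤ L := by exact_mod_cast hL
  have h1 : ((L : ℝ) ^ 2)⁻¹ ≤ 1 / 4 := by
    rw [inv_le_comm₀ (by positivity) (by norm_num)]
    nlinarith
  have h2 : ((L : ℝ) ^ (2 * k))⁻¹ ≤ ((L : ℝ) ^ 2)⁻¹ :=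
    inv_anti₀ (by positivity) (pow_le_pow_right₀ (by linarith) (by omega))
  have h3 : 0 ≤ ((L : ℝ) ^ (2 * k))⁻¹ := by positivity
  have h4 : 0 < 1 - ((L : ℝ) ^ (2 * k))⁻¹ := by linarith
  rw [aCoeff]
  constructor
  · rw [le_div_iff₀ h4]
    nlinarith [mul_nonneg ha h3, mul_le_mul_of_nonneg_left h1 ha]
  · rw [div_le_iff₀ h4]
    exact mul_le_mul_of_nonneg_left (by linarith) ha

theorem decayConst_mono {d : ℕ} {b b' γ : ℝ} (hγ : 0 < γ) (h : b ≤ b') :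
    decayConst d b γ ≤ decayConst d b' γ := by
  unfold decayConst
  gcongr

theorem decayConst_pos (d : ℕ) {b γ : ℝ} (hγ : 0 < γ) (hb : 0 ≤ b) : 0 < decayConst d b γ := by
  unfold decayConst
  positivity

/-- The spectral gap and the decay rate, as functions of `d` and `a` alone. -/
theorem exists_gap_and_rate {d : ℕ} (hd : 1 ≤ d) {a : ℝ} (ha : 0 < a) :
    ∃ γ α : ℝ, 0 < γ ∧ 0 < α ∧ γ * 4 ^ d ≤ 1 ∧ γ * 4 ^ d ≤ 3 / 4 * a ∧ 4 * α * d ≤ 1 ∧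
      2 * d * α ^ 2 + a * (α * d) ^ 2 ≤ γ / 2 := by
  have hd' : (1 : ℝ) ≤ d := by exact_mod_cast hd
  have hd0 : (0 : ℝ) < d := by linarith
  have h4 : (4 : ℝ) ^ d ≠ 0 := by positivity
  set γ := min 1 (3 / 4 * a) / (4 : ℝ) ^ d with hγ
  have hγ0 : 0 < γ := div_pos (lt_min one_pos (by positivity)) (by positivity)
  have hγm : γ * 4 ^ d = min 1 (3 / 4 * a) := div_mul_cancel₀ _ h4
  have hB : 0 < 2 * (d : ℝ) + a * d ^ 2 := by positivity
  set α := min (1 / (4 * (d : ℝ))) (γ / 2 / (2 * d + a * d ^ 2)) with hα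
  have hα0 : 0 < α := lt_min (by positivity) (by positivity)
  have hα1 : α * (4 * d) ≤ 1 := (le_div_iff₀ (by positivity)).mp (min_le_left _ _)
  have hα2 : α * (2 * d + a * d ^ 2) ≤ γ / 2 := (le_div_iff₀ hB).mp (min_le_right _ _)
  have hα3 : α ≤ 1 := by nlinarith
  refine ⟨γ, α, hγ0, hα0, hγm.trans_le (min_le_left _ _), hγm.trans_le (min_le_right _ _),
    by linarith, ?_⟩
  calc 2 * d * α ^ 2 + a * (α * d) ^ 2 = α * (α * (2 * d + a * d ^ 2)) := by ring
    _ ≤ 1 * (α * (2 * d + a * d ^ 2)) := mul_le_mul_of_nonneg_right hα3 (by positivity)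
    _ ≤ γ / 2 := by rwa [one_mul]

end LatticeGreen

end

open LatticeGreen

theorem mainTheorem2 (d : ℕ) (hd : 1 ≤ d) (a : ℝ) (ha : 0 < a) :
    ∃ c c₁ : ℝ, 0 < c ∧ 0 < c₁ ∧
      ∀ L k m : ℕ, 1 < L → Odd L → 1 ≤ k → k ≤ m → ∀ μ₀ : ℝ, 0 ≤ μ₀ →
        IsUnit (LatticeGreen.greenOperator d a μ₀ L k m) ∧
        ∀ (x : LatticeGreen.Fine d L m) (y : LatticeGreen.Coarse d L k m),
          ‖LatticeGreen.latticeKernel d (LatticeGreen.spacing L k) 1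
              (LatticeGreen.greenAveragingAdjoint d a μ₀ L k m) x y‖ ≤
            c * Real.exp (-c₁ * dist (LatticeGreen.position (LatticeGreen.spacing L k) x)
              (LatticeGreen.position 1 y)) ∧
          ‖LatticeGreen.latticeKernel d (LatticeGreen.spacing L k) 1
              (LatticeGreen.hOperator d a μ₀ L k m) x y‖ ≤
            c * Real.exp (-c₁ * dist (LatticeGreen.position (LatticeGreen.spacing L k) x)
              (LatticeGreen.position 1 y)) := by
  obtain ⟨γ, α, hγ, hα, hγ1, hγa, hαd, hrow⟩ := exists_gap_and_rate hd ha
  have hC := decayConst_pos d hγ ha.le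
  -- The factor `1 + a` accommodates `ℋ_k = a_k G_k Q^*` with `a_k ≤ a`.
  refine ⟨decayConst d a γ * (1 + a), α, by positivity, hα, ?_⟩
  intro L k m hL _ hk hkm μ₀ hμ₀
  have hL0 : 0 < L := by omega
  obtain ⟨hb1, hb2⟩ := aCoeff_bounds ha.le hL hk
  have hb : 0 ≤ aCoeff a L k := le_trans (by positivity) hb1
  have hν : 0 ≤ (L : ℝ) ^ (2 * k) * μ₀ := by positivity
  have hM : L ^ m = L ^ k * L ^ (m - k) := by rw [← pow_add, Nat.add_sub_cancel' hkm]
  have hN : 0 < L ^ k := pow_pos hL0 k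
  have hK : 0 < L ^ (m - k) := pow_pos hL0 _
  have hgap := greenMatrix_gap (d := d) hN hK hν hγ.le hγ1 (hγa.trans hb1)
  rw [← hM] at hgap
  have hT := isUnit_of_smul_one_le hγ hgap
  refine ⟨isUnit_of_ofReal hT (greenOperator_ofReal hL0 d a μ₀ k m), fun x y => ?_⟩
  obtain ⟨u, hu, hker⟩ := latticeKernel_greenAveragingAdjoint hL0 d a μ₀ k m hT y
  have hrow' : 2 * d * α ^ 2 + aCoeff a L k * (α * d) ^ 2 ≤ γ / 2 :=
    le_trans (by gcongr) hrow
  have hux := abs_solution_le hd hN hK hM hν hγ hb hα.le hαd hgap hrow' hu x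
  set δ := dist (position (spacing L k) x) (position 1 y) with hδ
  have hexp : Real.exp (-(α * taxi (sitePos (L ^ k) x) (fun i => ((y i : ℕ) : ℝ)))) ≤
      Real.exp (-α * δ) := by
    rw [Real.exp_le_exp, neg_mul, neg_le_neg_iff]
    exact mul_le_mul_of_nonneg_left (dist_position_le_taxi x y) hα.le
  have hmain : |u x| ≤ decayConst d a γ * Real.exp (-α * δ) :=
    hux.trans (mul_le_mul (decayConst_mono hγ hb2) hexp (Real.exp_pos _).le hC.le)
  have hE := Real.exp_pos (-α * δ)
  constructor
  · rw [hker x, Complex.norm_real, Real.norm_eq_abs]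
    refine hmain.trans (mul_le_mul_of_nonneg_right ?_ hE.le)
    exact le_mul_of_one_le_right hC.le (by linarith)
  · rw [latticeKernel_hOperator, hker x, norm_mul, Complex.norm_real, Complex.norm_real,
      Real.norm_eq_abs, Real.norm_eq_abs, abs_of_nonneg hb]
    calc aCoeff a L k * |u x| ≤ a * (decayConst d a γ * Real.exp (-α * δ)) :=
          mul_le_mul hb2 hmain (abs_nonneg _) ha.le
      _ ≤ decayConst d a γ * (1 + a) * Real.exp (-α * δ) := by
          nlinarith [mul_pos hC hE]
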